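/- Let $0<b\le a$, put $c=\sqrt{a^2-b^2}$ and $\delta_1=\sqrt{4a^2-b^2}$, and let $\mathcal E$ be the ellipse $x^2/a^2+y^2/b^2=1$ (foci $(\pm c,0)$). The Brocard inellipse of a triangle is the inscribed ellipse that is centered at the Brocard midpoint $X_{39}$ and touches each side at its intersection with the symmedian (the cevian through the symmedian point $X_6$) from the opposite vertex. A circle $\mathcal C$ and the ellipse $\mathcal E$ define a Brocard porism if they are the circumcircle and the Brocard inellipse of some triangle; the triangles of the porism are then all triangles that are inscribed in $\mathcal C$ and circumscribe $\mathcal E$ (all three sides are tangent to $\mathcal E$). The Brocard angle of a triangle $P_1P_2P_3$ is the angle $\omega$ for which there are interior points $\Omega_1,\Omega_2$ (the Brocard points) with $\angle\Omega_1P_iP_{i+1}=\omega$ and $\angle\Omega_2P_iP_{i-1}=\omega$ for $i=1,2,3$ (indices mod $3$). Proposition. For every such $a,b$ there is a circle $\mathcal C$, with center not above the $x$-axis, that defines a Brocard porism together with $\mathcal E$. For every such circle $\mathcal C$, the center $X_3$ and the radius $R$ of $\mathcal C$ are $$X_3=\Bigl(0,-\frac{c\,\delta_1}{b}\Bigr),\qquad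 R=\frac{2a^2}{b},$$ and all triangles of the porism have one and the same Brocard angle $\omega$, with $$\cot\omega=\frac{\delta_1}{b}.$$ -/

import Mathlib

open EuclideanGeometry

noncomputable section

namespace BrocardPorism

/-- The Euclidean plane. -/
abbrev Plane : Type := EuclideanSpace ℝ (Fin 2)

/-- A (nondegenerate) triangle in the plane. Vertex indices are taken in `Fin 3`, so `i + 1` and
`i + 2` are the two other vertices, and the side opposite to vertex `i` joins them. -/
abbrev PlaneTriangle : Type := Affine.Triangle ℝ Plane

/-- The ellipse centered at the origin with semi-axes `a`, `b` along the coordinate axes. -/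
def ellipse (a b : ℝ) : Set Plane :=
  {p | (p 0) ^ 2 / a ^ 2 + (p 1) ^ 2 / b ^ 2 = 1}

/-- The length of the side opposite to vertex `i`. -/
def sideLength (T : PlaneTriangle) (i : Fin 3) : ℝ :=
  dist (T.points (i + 1)) (T.points (i + 2))

/-- The point with homogeneous barycentric coordinates `w` with respect to `T`. -/
def barycentricPoint (T : PlaneTriangle) (w : Fin 3 → ℝ) : Plane :=
  (∑ i, w i)⁻¹ • ∑ i, w i • T.points i

/-- The symmedian point `X₆`, with barycentrics `s₁² : s₂² : s₃²`. -/
def symmedianPoint (T : PlaneTriangle) : Plane :=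
  barycentricPoint T fun i => sideLength T i ^ 2

/-- The Brocard midpoint `X₃₉`, with barycentrics `s₁² (s₂² + s₃²) : …`. -/
def brocardMidpoint (T : PlaneTriangle) : Plane :=
  barycentricPoint T fun i =>
    sideLength T i ^ 2 * (sideLength T (i + 1) ^ 2 + sideLength T (i + 2) ^ 2)

/-- The side of `T` opposite to vertex `i` is tangent at `p` to the ellipse `ellipse a b`:
the sideline meets the ellipse in `p` only, and `p` lies strictly between the two endpoints. -/
def SideTouchesAt (T : PlaneTriangle) (a b : ℝ) (i : Fin 3) (p : Plane) : Prop :=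
  ellipse a b ∩ (line[ℝ, T.points (i + 1), T.points (i + 2)] : Set Plane) = {p} ∧
    Sbtw ℝ (T.points (i + 1)) p (T.points (i + 2))

/-- `T` circumscribes `ellipse a b`: all three sides are tangent to it. -/
def Circumscribes (T : PlaneTriangle) (a b : ℝ) : Prop :=
  ∀ i, ∃ p, SideTouchesAt T a b i p

/-- `ellipse a b` is the Brocard inellipse of `T`: its center (the origin) is `X₃₉`, and its
Brianchon point is `X₆`, i.e. it touches each side on the symmedian (the cevian through `X₆`)
from the opposite vertex. -/
def IsBrocardInellipse (T : PlaneTriangle) (a b : ℝ) : Prop :=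
  brocardMidpoint T = 0 ∧
    ∀ i, ∃ p, SideTouchesAt T a b i p ∧ p ∈ line[ℝ, T.points i, symmedianPoint T]

/-- The circle `S` and the ellipse `ellipse a b` form the pair of a Brocard porism: they are the
circumcircle and the Brocard inellipse of some triangle. -/
def IsBrocardPorism (S : Sphere Plane) (a b : ℝ) : Prop :=
  ∃ T : PlaneTriangle, T.circumsphere = S ∧ IsBrocardInellipse T a b

/-- The triangles inscribed in the circle `S` and circumscribing `ellipse a b`. -/
def poristicTriangles (S : Sphere Plane) (a b : ℝ) : Set PlaneTriangle :=
  {T | (∀ i, T.points i ∈ S) ∧ Circumscribes T a b}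

/-- `ω` is the Brocard angle of `T`: there are points `Ω₁`, `Ω₂` inside the triangle (the first
and second Brocard points) such that for every vertex `P i` the ray to `Ω₁` makes the angle `ω`
with the side `P i P (i + 1)`, and the ray to `Ω₂` the angle `ω` with the side `P i P (i - 1)`. -/
def IsBrocardAngle (T : PlaneTriangle) (ω : ℝ) : Prop :=
  (∃ Ω₁ ∈ T.interior, ∀ i, ∠ Ω₁ (T.points i) (T.points (i + 1)) = ω) ∧
    ∃ Ω₂ ∈ T.interior, ∀ i, ∠ Ω₂ (T.points i) (T.points (i - 1)) = ω

end BrocardPorism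

end

namespace BrocardPorism

/-- The triangle with vertices `(xᵢ, yᵢ)` circumscribes the ellipse with semi-axes `a`, `b`, and
`l`, `m`, `n` are the off-diagonal coefficients of the dual conic of the ellipse in barycentric
coordinates, normalized to have sum `1`. -/
structure IsDualWeights (a b x₁ y₁ x₂ y₂ x₃ y₃ l m n : ℝ) : Prop where
  pos₁ : 0 < l
  pos₂ : 0 < m
  pos₃ : 0 < n
  sum_eq : l + m + n = 1
  eq_x : (m + n) * x₁ + (n + l) * x₂ + (l + m) * x₃ = 0
  eq_y : (m + n) * y₁ + (n + l) * y₂ + (l + m) * y₃ = 0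
  eq_xx : n * (x₁ * x₂) + m * (x₁ * x₃) + l * (x₂ * x₃) = -a ^ 2
  eq_yy : n * (y₁ * y₂) + m * (y₁ * y₃) + l * (y₂ * y₃) = -b ^ 2
  eq_xy : n * (x₁ * y₂ + x₂ * y₁) + m * (x₁ * y₃ + x₃ * y₁) + l * (x₂ * y₃ + x₃ * y₂) = 0

/-- Twice the signed area of a triangle. -/
def area₂ (x₁ y₁ x₂ y₂ x₃ y₃ : ℝ) : ℝ := (x₂ - x₁) * (y₃ - y₁) - (x₃ - x₁) * (y₂ - y₁)

/-- The line through `(x₂, y₂)` and `(x₃, y₃)` is the polar line, with respect to the ellipse,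
of the point dividing the segment in the ratio `t : 1 - t`. -/
structure IsTouchRatio (a b x₂ y₂ x₃ y₃ t : ℝ) : Prop where
  pos : 0 < t
  lt_one : t < 1
  left : x₂ * ((1 - t) * x₂ + t * x₃) / a ^ 2 + y₂ * ((1 - t) * y₂ + t * y₃) / b ^ 2 = 1
  right : x₃ * ((1 - t) * x₂ + t * x₃) / a ^ 2 + y₃ * ((1 - t) * y₂ + t * y₃) / b ^ 2 = 1

/-- The pole of a sideline determines its row of the dual conic. -/
theorem IsTouchRatio.dual_row {a b x₁ y₁ x₂ y₂ x₃ y₃ t α₁ β₁ γ₁ α₂ β₂ γ₂ α₃ β₃ γ₃ : ℝ}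
    (ha : a ≠ 0) (hb : b ≠ 0) (h : IsTouchRatio a b x₂ y₂ x₃ y₃ t)
    (hD : area₂ x₁ y₁ x₂ y₂ x₃ y₃ ≠ 0)
    (hα₁ : α₁ * area₂ x₁ y₁ x₂ y₂ x₃ y₃ = y₂ - y₃)
    (hβ₁ : β₁ * area₂ x₁ y₁ x₂ y₂ x₃ y₃ = x₃ - x₂)
    (hγ₁ : γ₁ * area₂ x₁ y₁ x₂ y₂ x₃ y₃ = x₂ * y₃ - x₃ * y₂)
    (h11 : α₁ * x₁ + β₁ * y₁ + γ₁ = 1)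
    (h12 : α₁ * x₂ + β₁ * y₂ + γ₁ = 0) (h13 : α₁ * x₃ + β₁ * y₃ + γ₁ = 0)
    (h22 : α₂ * x₂ + β₂ * y₂ + γ₂ = 1) (h23 : α₂ * x₃ + β₂ * y₃ + γ₂ = 0)
    (h32 : α₃ * x₂ + β₃ * y₂ + γ₃ = 0) (h33 : α₃ * x₃ + β₃ * y₃ + γ₃ = 1) :
    γ₁ ≠ 0 ∧ -a ^ 2 * α₁ * α₁ - b ^ 2 * β₁ * β₁ + γ₁ * γ₁ = 0 ∧
      -a ^ 2 * α₁ * α₂ - b ^ 2 * β₁ * β₂ + γ₁ * γ₂ = γ₁ * (1 - t) ∧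
      -a ^ 2 * α₁ * α₃ - b ^ 2 * β₁ * β₃ + γ₁ * γ₃ = γ₁ * t := by
  obtain ⟨-, -, h2, h3⟩ := h
  set D := area₂ x₁ y₁ x₂ y₂ x₃ y₃
  set X := (1 - t) * x₂ + t * x₃ with hX
  set Y := (1 - t) * y₂ + t * y₃ with hY
  obtain ⟨u, hu⟩ : ∃ u, u = X / a ^ 2 := ⟨_, rfl⟩
  obtain ⟨v, hv⟩ : ∃ v, v = Y / b ^ 2 := ⟨_, rfl⟩
  have hXu : X = a ^ 2 * u := by rw [hu]; field_simp
  have hYv : Y = b ^ 2 * v := by rw [hv]; field_simp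
  have h2' : x₂ * u + y₂ * v = 1 := by rw [← h2, hu, hv]; ring
  have h3' : x₃ * u + y₃ * v = 1 := by rw [← h3, hu, hv]; ring
  have hα : α₁ = -(γ₁ * u) := by
    apply mul_right_cancel₀ hD
    linear_combination hα₁ + u * hγ₁ + y₃ * h2' - y₂ * h3'
  have hβ : β₁ = -(γ₁ * v) := by
    apply mul_right_cancel₀ hD
    linear_combination hβ₁ + v * hγ₁ - x₃ * h2' + x₂ * h3'
  refine ⟨?_, ?_, ?_, ?_⟩
  · rintro h0
    simp [hα, hβ, h0] at h11
  · have e : -a ^ 2 * α₁ * α₁ - b ^ 2 * β₁ * β₁ + γ₁ * γ₁ = γ₁ * (X * α₁ + Y * β₁ + γ₁) := by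
      rw [hXu, hYv]; nth_rewrite 1 [hα]; nth_rewrite 1 [hβ]; ring
    rw [e, hX, hY]
    linear_combination γ₁ * (1 - t) * h12 + γ₁ * t * h13
  · have e : -a ^ 2 * α₁ * α₂ - b ^ 2 * β₁ * β₂ + γ₁ * γ₂ = γ₁ * (X * α₂ + Y * β₂ + γ₂) := by
      rw [hXu, hYv, hα, hβ]; ring
    rw [e, hX, hY]
    linear_combination γ₁ * (1 - t) * h22 + γ₁ * t * h23
  · have e : -a ^ 2 * α₁ * α₃ - b ^ 2 * β₁ * β₃ + γ₁ * γ₃ = γ₁ * (X * α₃ + Y * β₃ + γ₃) := by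
      rw [hXu, hYv, hα, hβ]; ring
    rw [e, hX, hY]
    linear_combination γ₁ * (1 - t) * h32 + γ₁ * t * h33

theorem pos_of_mul_pos_of_sum_eq_one {l m n : ℝ} (nm : 0 < n * m) (nl : 0 < n * l)
    (h : l + m + n = 1) : 0 < n := by
  rcases pos_and_pos_or_neg_and_neg_of_mul_pos nm with ⟨hn, -⟩ | ⟨hn, hm⟩
  · exact hn
  · have hl : l < 0 := neg_of_mul_pos_right nl hn.le
    linarith

theorem exists_isDualWeights {a b x₁ y₁ x₂ y₂ x₃ y₃ t₁ t₂ t₃ : ℝ}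
    (ha : a ≠ 0) (hb : b ≠ 0) (hD : area₂ x₁ y₁ x₂ y₂ x₃ y₃ ≠ 0)
    (h₁ : IsTouchRatio a b x₂ y₂ x₃ y₃ t₁) (h₂ : IsTouchRatio a b x₃ y₃ x₁ y₁ t₂)
    (h₃ : IsTouchRatio a b x₁ y₁ x₂ y₂ t₃) :
    ∃ l m n, IsDualWeights a b x₁ y₁ x₂ y₂ x₃ y₃ l m n ∧
      n * t₁ = m * (1 - t₁) ∧ l * t₂ = n * (1 - t₂) ∧ m * t₃ = l * (1 - t₃) := by
  obtain ⟨D, hDe⟩ : ∃ D, D = area₂ x₁ y₁ x₂ y₂ x₃ y₃ := ⟨_, rfl⟩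
  have hD1 : D = (x₂ - x₁) * (y₃ - y₁) - (x₃ - x₁) * (y₂ - y₁) := hDe
  have hD2 : area₂ x₂ y₂ x₃ y₃ x₁ y₁ = D := by rw [hD1, area₂]; ring
  have hD3 : area₂ x₃ y₃ x₁ y₁ x₂ y₂ = D := by rw [hD1, area₂]; ring
  have hD0 : D ≠ 0 := hDe ▸ hD
  obtain ⟨α₁, hα₁⟩ : ∃ u, u * D = y₂ - y₃ := ⟨(y₂ - y₃) / D, by field_simp⟩
  obtain ⟨α₂, hα₂⟩ : ∃ u, u * D = y₃ - y₁ := ⟨(y₃ - y₁) / D, by field_simp⟩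
  obtain ⟨α₃, hα₃⟩ : ∃ u, u * D = y₁ - y₂ := ⟨(y₁ - y₂) / D, by field_simp⟩
  obtain ⟨β₁, hβ₁⟩ : ∃ u, u * D = x₃ - x₂ := ⟨(x₃ - x₂) / D, by field_simp⟩
  obtain ⟨β₂, hβ₂⟩ : ∃ u, u * D = x₁ - x₃ := ⟨(x₁ - x₃) / D, by field_simp⟩
  obtain ⟨β₃, hβ₃⟩ : ∃ u, u * D = x₂ - x₁ := ⟨(x₂ - x₁) / D, by field_simp⟩
  obtain ⟨γ₁, hγ₁⟩ : ∃ u, u * D = x₂ * y₃ - x₃ * y₂ := ⟨(x₂ * y₃ - x₃ * y₂) / D, by field_simp⟩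
  obtain ⟨γ₂, hγ₂⟩ : ∃ u, u * D = x₃ * y₁ - x₁ * y₃ := ⟨(x₃ * y₁ - x₁ * y₃) / D, by field_simp⟩
  obtain ⟨γ₃, hγ₃⟩ : ∃ u, u * D = x₁ * y₂ - x₂ * y₁ := ⟨(x₁ * y₂ - x₂ * y₁) / D, by field_simp⟩
  have e11 : α₁ * x₁ + β₁ * y₁ + γ₁ = 1 := mul_right_cancel₀ hD0 (by
    linear_combination x₁ * hα₁ + y₁ * hβ₁ + hγ₁ - hD1)
  have e12 : α₁ * x₂ + β₁ * y₂ + γ₁ = 0 := mul_right_cancel₀ hD0 (by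
    linear_combination x₂ * hα₁ + y₂ * hβ₁ + hγ₁)
  have e13 : α₁ * x₃ + β₁ * y₃ + γ₁ = 0 := mul_right_cancel₀ hD0 (by
    linear_combination x₃ * hα₁ + y₃ * hβ₁ + hγ₁)
  have e21 : α₂ * x₁ + β₂ * y₁ + γ₂ = 0 := mul_right_cancel₀ hD0 (by
    linear_combination x₁ * hα₂ + y₁ * hβ₂ + hγ₂)
  have e22 : α₂ * x₂ + β₂ * y₂ + γ₂ = 1 := mul_right_cancel₀ hD0 (by
    linear_combination x₂ * hα₂ + y₂ * hβ₂ + hγ₂ - hD1)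
  have e23 : α₂ * x₃ + β₂ * y₃ + γ₂ = 0 := mul_right_cancel₀ hD0 (by
    linear_combination x₃ * hα₂ + y₃ * hβ₂ + hγ₂)
  have e31 : α₃ * x₁ + β₃ * y₁ + γ₃ = 0 := mul_right_cancel₀ hD0 (by
    linear_combination x₁ * hα₃ + y₁ * hβ₃ + hγ₃)
  have e32 : α₃ * x₂ + β₃ * y₂ + γ₃ = 0 := mul_right_cancel₀ hD0 (by
    linear_combination x₂ * hα₃ + y₂ * hβ₃ + hγ₃)
  have e33 : α₃ * x₃ + β₃ * y₃ + γ₃ = 1 := mul_right_cancel₀ hD0 (by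
    linear_combination x₃ * hα₃ + y₃ * hβ₃ + hγ₃ - hD1)
  have sα : α₁ + α₂ + α₃ = 0 := mul_right_cancel₀ hD0 (by
    linear_combination hα₁ + hα₂ + hα₃)
  have sβ : β₁ + β₂ + β₃ = 0 := mul_right_cancel₀ hD0 (by
    linear_combination hβ₁ + hβ₂ + hβ₃)
  have sγ : γ₁ + γ₂ + γ₃ = 1 := by
    linear_combination e11 + e21 + e31 - x₁ * sα - y₁ * sβ
  have sαx : α₁ * x₁ + α₂ * x₂ + α₃ * x₃ = 1 := mul_right_cancel₀ hD0 (by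
    linear_combination x₁ * hα₁ + x₂ * hα₂ + x₃ * hα₃ - hD1)
  have sβx : β₁ * x₁ + β₂ * x₂ + β₃ * x₃ = 0 := mul_right_cancel₀ hD0 (by
    linear_combination x₁ * hβ₁ + x₂ * hβ₂ + x₃ * hβ₃)
  have sγx : γ₁ * x₁ + γ₂ * x₂ + γ₃ * x₃ = 0 := mul_right_cancel₀ hD0 (by
    linear_combination x₁ * hγ₁ + x₂ * hγ₂ + x₃ * hγ₃)
  have sαy : α₁ * y₁ + α₂ * y₂ + α₃ * y₃ = 0 := mul_right_cancel₀ hD0 (by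
    linear_combination y₁ * hα₁ + y₂ * hα₂ + y₃ * hα₃)
  have sβy : β₁ * y₁ + β₂ * y₂ + β₃ * y₃ = 1 := mul_right_cancel₀ hD0 (by
    linear_combination y₁ * hβ₁ + y₂ * hβ₂ + y₃ * hβ₃ - hD1)
  have sγy : γ₁ * y₁ + γ₂ * y₂ + γ₃ * y₃ = 0 := mul_right_cancel₀ hD0 (by
    linear_combination y₁ * hγ₁ + y₂ * hγ₂ + y₃ * hγ₃)
  obtain ⟨g1, d1, r12, r13⟩ := h₁.dual_row ha hb hD (by rwa [← hDe]) (by rwa [← hDe])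
    (by rwa [← hDe]) e11 e12 e13 e22 e23 e32 e33
  obtain ⟨g2, d2, r23, r21⟩ := h₂.dual_row ha hb (by rwa [hD2]) (by rwa [hD2]) (by rwa [hD2])
    (by rwa [hD2]) e22 e23 e21 e33 e31 e13 e11
  obtain ⟨g3, d3, r31, r32⟩ := h₃.dual_row ha hb (by rwa [hD3]) (by rwa [hD3]) (by rwa [hD3])
    (by rwa [hD3]) e33 e31 e32 e11 e12 e21 e22
  obtain ⟨n, hn⟩ : ∃ n, n = 2 * (-a ^ 2 * α₁ * α₂ - b ^ 2 * β₁ * β₂ + γ₁ * γ₂) := ⟨_, rfl⟩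
  obtain ⟨m, hm⟩ : ∃ m, m = 2 * (-a ^ 2 * α₁ * α₃ - b ^ 2 * β₁ * β₃ + γ₁ * γ₃) := ⟨_, rfl⟩
  obtain ⟨l, hl⟩ : ∃ l, l = 2 * (-a ^ 2 * α₂ * α₃ - b ^ 2 * β₂ * β₃ + γ₂ * γ₃) := ⟨_, rfl⟩
  have n1 : n = 2 * (γ₁ * (1 - t₁)) := by rw [hn, r12]
  have m1 : m = 2 * (γ₁ * t₁) := by rw [hm, r13]
  have l2 : l = 2 * (γ₂ * (1 - t₂)) := by rw [hl, r23]
  have n2 : n = 2 * (γ₂ * t₂) := by rw [hn, ← r21]; ring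
  have m3 : m = 2 * (γ₃ * (1 - t₃)) := by rw [hm, ← r31]; ring
  have l3 : l = 2 * (γ₃ * t₃) := by rw [hl, ← r32]; ring
  have hsum : l + m + n = 1 := by
    linear_combination hl + hm + hn - d1 - d2 - d3 - a ^ 2 * (α₁ + α₂ + α₃) * sα
      - b ^ 2 * (β₁ + β₂ + β₃) * sβ + (γ₁ + γ₂ + γ₃ + 1) * sγ
  have nm : 0 < n * m := by
    have : n * m = γ₁ ^ 2 * (4 * ((1 - t₁) * t₁)) := by rw [n1, m1]; ring
    rw [this]
    have := h₁.pos; have := sub_pos.2 h₁.lt_one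
    positivity
  have nl : 0 < n * l := by
    have : n * l = γ₂ ^ 2 * (4 * ((1 - t₂) * t₂)) := by rw [n2, l2]; ring
    rw [this]
    have := h₂.pos; have := sub_pos.2 h₂.lt_one
    positivity
  have hnpos : 0 < n := pos_of_mul_pos_of_sum_eq_one nm nl hsum
  refine ⟨l, m, n, ⟨pos_of_mul_pos_right nl hnpos.le, pos_of_mul_pos_right nm hnpos.le, hnpos, hsum,
    ?_, ?_, ?_, ?_, ?_⟩, ?_, ?_, ?_⟩
  · linear_combination x₁ * (hm + hn) + x₂ * (hn + hl) + x₃ * (hl + hm)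
      - 2 * x₁ * d1 - 2 * x₂ * d2 - 2 * x₃ * d3 - 2 * a ^ 2 * (α₁ * x₁ + α₂ * x₂ + α₃ * x₃) * sα
      - 2 * b ^ 2 * (β₁ * x₁ + β₂ * x₂ + β₃ * x₃) * sβ + 2 * (γ₁ + γ₂ + γ₃) * sγx
  · linear_combination y₁ * (hm + hn) + y₂ * (hn + hl) + y₃ * (hl + hm)
      - 2 * y₁ * d1 - 2 * y₂ * d2 - 2 * y₃ * d3 - 2 * a ^ 2 * (α₁ * y₁ + α₂ * y₂ + α₃ * y₃) * sα
      - 2 * b ^ 2 * (β₁ * y₁ + β₂ * y₂ + β₃ * y₃) * sβ + 2 * (γ₁ + γ₂ + γ₃) * sγy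
  · linear_combination x₁ * x₂ * hn + x₁ * x₃ * hm + x₂ * x₃ * hl
      - x₁ ^ 2 * d1 - x₂ ^ 2 * d2 - x₃ ^ 2 * d3
      - a ^ 2 * (α₁ * x₁ + α₂ * x₂ + α₃ * x₃ + 1) * sαx
      - b ^ 2 * (β₁ * x₁ + β₂ * x₂ + β₃ * x₃) * sβx + (γ₁ * x₁ + γ₂ * x₂ + γ₃ * x₃) * sγx
  · linear_combination y₁ * y₂ * hn + y₁ * y₃ * hm + y₂ * y₃ * hl
      - y₁ ^ 2 * d1 - y₂ ^ 2 * d2 - y₃ ^ 2 * d3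
      - a ^ 2 * (α₁ * y₁ + α₂ * y₂ + α₃ * y₃) * sαy
      - b ^ 2 * (β₁ * y₁ + β₂ * y₂ + β₃ * y₃ + 1) * sβy + (γ₁ * y₁ + γ₂ * y₂ + γ₃ * y₃) * sγy
  · linear_combination (x₁ * y₂ + x₂ * y₁) * hn + (x₁ * y₃ + x₃ * y₁) * hm
      + (x₂ * y₃ + x₃ * y₂) * hl - 2 * x₁ * y₁ * d1 - 2 * x₂ * y₂ * d2 - 2 * x₃ * y₃ * d3
      - 2 * a ^ 2 * (α₁ * x₁ + α₂ * x₂ + α₃ * x₃) * sαy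
      - 2 * b ^ 2 * (β₁ * y₁ + β₂ * y₂ + β₃ * y₃) * sβx
      + 2 * (γ₁ * x₁ + γ₂ * x₂ + γ₃ * x₃) * sγy
  · rw [n1, m1]; ring
  · rw [n2, l2]; ring
  · rw [m3, l3]; ring

section Invariants

variable {a b x₁ y₁ x₂ y₂ x₃ y₃ l m n p q ρ S₁ S₂ S₃ : ℝ}

theorem four_mul_area₂_sq (h₁ : S₁ = (x₂ - x₃) ^ 2 + (y₂ - y₃) ^ 2)
    (h₂ : S₂ = (x₃ - x₁) ^ 2 + (y₃ - y₁) ^ 2) (h₃ : S₃ = (x₁ - x₂) ^ 2 + (y₁ - y₂) ^ 2) :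
    4 * area₂ x₁ y₁ x₂ y₂ x₃ y₃ ^ 2 =
      2 * (S₁ * S₂ + S₂ * S₃ + S₃ * S₁) - (S₁ ^ 2 + S₂ ^ 2 + S₃ ^ 2) := by
  rw [h₁, h₂, h₃, area₂]; ring

/-- The squared side lengths of a triangle inscribed in a circle of squared radius `ρ`. -/
theorem mul_sq_sides_eq (h₁ : S₁ = (x₂ - x₃) ^ 2 + (y₂ - y₃) ^ 2)
    (h₂ : S₂ = (x₃ - x₁) ^ 2 + (y₃ - y₁) ^ 2) (h₃ : S₃ = (x₁ - x₂) ^ 2 + (y₁ - y₂) ^ 2)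
    (c₁ : (x₁ - p) ^ 2 + (y₁ - q) ^ 2 = ρ) (c₂ : (x₂ - p) ^ 2 + (y₂ - q) ^ 2 = ρ)
    (c₃ : (x₃ - p) ^ 2 + (y₃ - q) ^ 2 = ρ) :
    S₁ * S₂ * S₃ = 4 * ρ * area₂ x₁ y₁ x₂ y₂ x₃ y₃ ^ 2 := by
  obtain ⟨g₁, hg₁⟩ : ∃ g, g = (x₂ - p) * (x₃ - p) + (y₂ - q) * (y₃ - q) := ⟨_, rfl⟩
  obtain ⟨g₂, hg₂⟩ : ∃ g, g = (x₃ - p) * (x₁ - p) + (y₃ - q) * (y₁ - q) := ⟨_, rfl⟩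
  obtain ⟨g₃, hg₃⟩ : ∃ g, g = (x₁ - p) * (x₂ - p) + (y₁ - q) * (y₂ - q) := ⟨_, rfl⟩
  have hdet : ((x₁ - p) ^ 2 + (y₁ - q) ^ 2) * ((x₂ - p) ^ 2 + (y₂ - q) ^ 2)
      * ((x₃ - p) ^ 2 + (y₃ - q) ^ 2) + 2 * g₁ * g₂ * g₃
      - ((x₁ - p) ^ 2 + (y₁ - q) ^ 2) * g₁ ^ 2 - ((x₂ - p) ^ 2 + (y₂ - q) ^ 2) * g₂ ^ 2
      - ((x₃ - p) ^ 2 + (y₃ - q) ^ 2) * g₃ ^ 2 = 0 := by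
    rw [hg₁, hg₂, hg₃]; ring
  rw [c₁, c₂, c₃] at hdet
  have s₁ : S₁ = 2 * ρ - 2 * g₁ := by linear_combination h₁ + 2 * hg₁ + c₂ + c₃
  have s₂ : S₂ = 2 * ρ - 2 * g₂ := by linear_combination h₂ + 2 * hg₂ + c₃ + c₁
  have s₃ : S₃ = 2 * ρ - 2 * g₃ := by linear_combination h₃ + 2 * hg₃ + c₁ + c₂
  have hH := four_mul_area₂_sq h₁ h₂ h₃
  have : 4 * ρ * area₂ x₁ y₁ x₂ y₂ x₃ y₃ ^ 2 = ρ * (4 * area₂ x₁ y₁ x₂ y₂ x₃ y₃ ^ 2) := by ring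
  rw [this, hH, s₁, s₂, s₃]
  linear_combination -4 * hdet

theorem IsDualWeights.area₂_sq_mul (h : IsDualWeights a b x₁ y₁ x₂ y₂ x₃ y₃ l m n) :
    area₂ x₁ y₁ x₂ y₂ x₃ y₃ ^ 2 * (l * m * n) = 4 * (a ^ 2 * b ^ 2) := by
  obtain ⟨-, -, -, hs, hx, hy, hxx, hyy, hxy⟩ := h
  have key : area₂ x₁ y₁ x₂ y₂ x₃ y₃ ^ 2 * (l * m * n) =
      4 * ((n * (x₁ * x₂) + m * (x₁ * x₃) + l * (x₂ * x₃))
        * (n * (y₁ * y₂) + m * (y₁ * y₃) + l * (y₂ * y₃)) * (l + m + n))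
      - (n * (x₁ * y₂ + x₂ * y₁) + m * (x₁ * y₃ + x₃ * y₁) + l * (x₂ * y₃ + x₃ * y₂)) ^ 2
        * (l + m + n)
      + (n * (x₁ * y₂ + x₂ * y₁) + m * (x₁ * y₃ + x₃ * y₁) + l * (x₂ * y₃ + x₃ * y₂))
        * ((m + n) * x₁ + (n + l) * x₂ + (l + m) * x₃)
        * ((m + n) * y₁ + (n + l) * y₂ + (l + m) * y₃)
      - (n * (x₁ * x₂) + m * (x₁ * x₃) + l * (x₂ * x₃))
        * ((m + n) * y₁ + (n + l) * y₂ + (l + m) * y₃) ^ 2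
      - (n * (y₁ * y₂) + m * (y₁ * y₃) + l * (y₂ * y₃))
        * ((m + n) * x₁ + (n + l) * x₂ + (l + m) * x₃) ^ 2 := by
    rw [area₂]; ring
  rw [key, hs, hx, hy, hxx, hyy, hxy]; ring

theorem IsDualWeights.sum_mul_sq_sides (h : IsDualWeights a b x₁ y₁ x₂ y₂ x₃ y₃ l m n)
    (h₁ : S₁ = (x₂ - x₃) ^ 2 + (y₂ - y₃) ^ 2)
    (h₂ : S₂ = (x₃ - x₁) ^ 2 + (y₃ - y₁) ^ 2) (h₃ : S₃ = (x₁ - x₂) ^ 2 + (y₁ - y₂) ^ 2)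
    (c₁ : (x₁ - p) ^ 2 + (y₁ - q) ^ 2 = ρ) (c₂ : (x₂ - p) ^ 2 + (y₂ - q) ^ 2 = ρ)
    (c₃ : (x₃ - p) ^ 2 + (y₃ - q) ^ 2 = ρ) :
    l * S₁ + m * S₂ + n * S₃ = 2 * (a ^ 2 + b ^ 2 + (ρ - p ^ 2 - q ^ 2)) := by
  obtain ⟨-, -, -, hs, hx, hy, hxx, hyy, hxy⟩ := h
  linear_combination l * h₁ + m * h₂ + n * h₃ + (m + n) * c₁ + (n + l) * c₂ + (l + m) * c₃
    - 2 * hxx - 2 * hyy + 2 * p * hx + 2 * q * hy + 2 * (ρ - p ^ 2 - q ^ 2) * hs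

theorem IsDualWeights.sum_sq_sides_mul (h : IsDualWeights a b x₁ y₁ x₂ y₂ x₃ y₃ l m n)
    (h₁ : S₁ = (x₂ - x₃) ^ 2 + (y₂ - y₃) ^ 2)
    (h₂ : S₂ = (x₃ - x₁) ^ 2 + (y₃ - y₁) ^ 2) (h₃ : S₃ = (x₁ - x₂) ^ 2 + (y₁ - y₂) ^ 2)
    (c₁ : (x₁ - p) ^ 2 + (y₁ - q) ^ 2 = ρ) (c₂ : (x₂ - p) ^ 2 + (y₂ - q) ^ 2 = ρ)
    (c₃ : (x₃ - p) ^ 2 + (y₃ - q) ^ 2 = ρ) :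
    S₁ * (m * n) + S₂ * (n * l) + S₃ * (l * m) =
      2 * (ρ - p ^ 2 - q ^ 2) - 2 * (a ^ 2 + b ^ 2) := by
  have hI := h.sum_mul_sq_sides h₁ h₂ h₃ c₁ c₂ c₃
  obtain ⟨-, -, -, hs, hx, hy, hxx, hyy, hxy⟩ := h
  have e : S₁ * ((n + l) * (l + m)) + S₂ * ((l + m) * (m + n)) + S₃ * ((m + n) * (n + l))
      = 4 * (ρ - p ^ 2 - q ^ 2) := by
    have hX : (m + n) * (x₁ - p) + (n + l) * (x₂ - p) + (l + m) * (x₃ - p) = -2 * p := by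
      linear_combination hx - 2 * p * hs
    have hY : (m + n) * (y₁ - q) + (n + l) * (y₂ - q) + (l + m) * (y₃ - q) = -2 * q := by
      linear_combination hy - 2 * q * hs
    have k : S₁ * ((n + l) * (l + m)) + S₂ * ((l + m) * (m + n)) + S₃ * ((m + n) * (n + l))
        = 2 * (l + m + n) * ((m + n) * ((x₁ - p) ^ 2 + (y₁ - q) ^ 2)
          + (n + l) * ((x₂ - p) ^ 2 + (y₂ - q) ^ 2) + (l + m) * ((x₃ - p) ^ 2 + (y₃ - q) ^ 2))
          - ((m + n) * (x₁ - p) + (n + l) * (x₂ - p) + (l + m) * (x₃ - p)) ^ 2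
          - ((m + n) * (y₁ - q) + (n + l) * (y₂ - q) + (l + m) * (y₃ - q)) ^ 2 := by
      rw [h₁, h₂, h₃]; ring
    rw [k, hX, hY, c₁, c₂, c₃]
    linear_combination (4 * ρ * (l + m + n) + 4 * ρ) * hs
  linear_combination e - hI - (l * S₁ + m * S₂ + n * S₃) * hs

theorem IsDualWeights.inner_circumcenter (h : IsDualWeights a b x₁ y₁ x₂ y₂ x₃ y₃ l m n)
    (h₂ : S₂ = (x₃ - x₁) ^ 2 + (y₃ - y₁) ^ 2) (h₃ : S₃ = (x₁ - x₂) ^ 2 + (y₁ - y₂) ^ 2)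
    (c₁ : (x₁ - p) ^ 2 + (y₁ - q) ^ 2 = ρ) (c₂ : (x₂ - p) ^ 2 + (y₂ - q) ^ 2 = ρ)
    (c₃ : (x₃ - p) ^ 2 + (y₃ - q) ^ 2 = ρ) :
    4 * (p * x₁ + q * y₁) = (n + l) * S₃ + (l + m) * S₂ - 4 * (ρ - p ^ 2 - q ^ 2) := by
  obtain ⟨-, -, -, hs, hx, hy, hxx, hyy, hxy⟩ := h
  linear_combination -(n + l) * h₃ - (l + m) * h₂ - (m + n) * c₁ - (n + l) * c₂ - (l + m) * c₃
    - 2 * c₁ + 2 * x₁ * hx + 2 * y₁ * hy - 2 * p * hx - 2 * q * hy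
    - 2 * (ρ - p ^ 2 - q ^ 2 + x₁ ^ 2 + y₁ ^ 2) * hs

theorem IsDualWeights.rotate (h : IsDualWeights a b x₁ y₁ x₂ y₂ x₃ y₃ l m n) :
    IsDualWeights a b x₂ y₂ x₃ y₃ x₁ y₁ m n l := by
  obtain ⟨hl, hm, hn, hs, hx, hy, hxx, hyy, hxy⟩ := h
  exact ⟨hm, hn, hl, by linarith, by linarith, by linarith, by linarith, by linarith, by linarith⟩

theorem eq_of_sum_eq_of_mul_eq {x y z k : ℝ} (hx : 0 < x) (hy : 0 < y) (hz : 0 < z)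
    (hs : x + y + z = 3 * k) (hp : x * y * z = k ^ 3) : x = k ∧ y = k ∧ z = k := by
  have e : (x + y + z) / 2 * ((x - y) ^ 2 + (y - z) ^ 2 + (z - x) ^ 2)
      + 3 * (x * (y - z) ^ 2 + y * (z - x) ^ 2 + z * (x - y) ^ 2) = 0 := by
    have : (x + y + z) ^ 3 - 27 * (x * y * z) = 0 := by rw [hs, hp]; ring
    linear_combination this
  have h1 : 0 ≤ 3 * (x * (y - z) ^ 2 + y * (z - x) ^ 2 + z * (x - y) ^ 2) := by positivity
  have h2 : (x - y) ^ 2 + (y - z) ^ 2 + (z - x) ^ 2 ≤ 0 := by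
    by_contra! h
    have : 0 < (x + y + z) / 2 * ((x - y) ^ 2 + (y - z) ^ 2 + (z - x) ^ 2) := by positivity
    linarith
  have h3 : x - y = 0 := by
    rw [← sq_eq_zero_iff]; nlinarith [sq_nonneg (x - y), sq_nonneg (y - z), sq_nonneg (z - x)]
  have h4 : y - z = 0 := by
    rw [← sq_eq_zero_iff]; nlinarith [sq_nonneg (x - y), sq_nonneg (y - z), sq_nonneg (z - x)]
  exact ⟨by linarith, by linarith, by linarith⟩

theorem IsDualWeights.area₂_ne_zero (ha : a ≠ 0) (hb : b ≠ 0)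
    (h : IsDualWeights a b x₁ y₁ x₂ y₂ x₃ y₃ l m n) : area₂ x₁ y₁ x₂ y₂ x₃ y₃ ≠ 0 := by
  intro h0
  have := h.area₂_sq_mul
  rw [h0] at this
  have : a ^ 2 * b ^ 2 = 0 := by linarith
  simp_all

theorem sq_side_pos (h₁ : S₁ = (x₂ - x₃) ^ 2 + (y₂ - y₃) ^ 2)
    (hD : area₂ x₁ y₁ x₂ y₂ x₃ y₃ ≠ 0) : 0 < S₁ := by
  rw [h₁]
  by_contra! h
  have hx : x₂ = x₃ := by
    rw [← sub_eq_zero, ← sq_eq_zero_iff]; nlinarith [sq_nonneg (x₂ - x₃), sq_nonneg (y₂ - y₃)]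
  have hy : y₂ = y₃ := by
    rw [← sub_eq_zero, ← sq_eq_zero_iff]; nlinarith [sq_nonneg (x₂ - x₃), sq_nonneg (y₂ - y₃)]
  exact hD (by rw [area₂, hx, hy]; ring)

theorem area₂_rotate : area₂ x₂ y₂ x₃ y₃ x₁ y₁ = area₂ x₁ y₁ x₂ y₂ x₃ y₃ := by
  rw [area₂, area₂]; ring

/-- A triangle circumscribing the ellipse and inscribed in the circle of the Brocard porism
satisfies the defining relation of the Brocard angle. -/
theorem IsDualWeights.sq_sum_sq_sides (ha : a ≠ 0) (hb : b ≠ 0)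
    (h : IsDualWeights a b x₁ y₁ x₂ y₂ x₃ y₃ l m n)
    (h₁ : S₁ = (x₂ - x₃) ^ 2 + (y₂ - y₃) ^ 2)
    (h₂ : S₂ = (x₃ - x₁) ^ 2 + (y₃ - y₁) ^ 2) (h₃ : S₃ = (x₁ - x₂) ^ 2 + (y₁ - y₂) ^ 2)
    (c₁ : (x₁ - p) ^ 2 + (y₁ - q) ^ 2 = ρ) (c₂ : (x₂ - p) ^ 2 + (y₂ - q) ^ 2 = ρ)
    (c₃ : (x₃ - p) ^ 2 + (y₃ - q) ^ 2 = ρ)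
    (hρ : ρ * b ^ 2 = 4 * a ^ 4) (hw : ρ - p ^ 2 - q ^ 2 = 5 * a ^ 2 - b ^ 2) :
    (S₁ + S₂ + S₃) ^ 2 * b ^ 2
      = (4 * a ^ 2 - b ^ 2) * (4 * area₂ x₁ y₁ x₂ y₂ x₃ y₃ ^ 2) := by
  have hD := h.area₂_ne_zero ha hb
  have p₁ := sq_side_pos h₁ hD
  have p₂ := sq_side_pos h₂ (by rwa [area₂_rotate])
  have p₃ := sq_side_pos h₃ (by rwa [area₂_rotate, area₂_rotate])
  have i1 := h.sum_mul_sq_sides h₁ h₂ h₃ c₁ c₂ c₃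
  have i2 := h.sum_sq_sides_mul h₁ h₂ h₃ c₁ c₂ c₃
  have i3 := h.area₂_sq_mul
  have i4 := mul_sq_sides_eq h₁ h₂ h₃ c₁ c₂ c₃
  have i5 := four_mul_area₂_sq h₁ h₂ h₃
  have hs := h.sum_eq
  have hl := h.pos₁
  have hm := h.pos₂
  have hn := h.pos₃
  rw [hw] at i1 i2
  obtain ⟨e1, e2, e3⟩ := eq_of_sum_eq_of_mul_eq (k := 4 * a ^ 2) (mul_pos hl p₁) (mul_pos hm p₂)
    (mul_pos hn p₃) (by linear_combination i1)
    (by linear_combination l * m * n * i4 + 4 * ρ * i3 + 16 * a ^ 2 * hρ)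
  have s2 : 4 * a ^ 2 * (S₁ * S₂ + S₂ * S₃ + S₃ * S₁) = S₁ * S₂ * S₃ := by
    linear_combination S₁ * S₂ * S₃ * hs - S₂ * S₃ * e1 - S₃ * S₁ * e2 - S₁ * S₂ * e3
  have s4 : 16 * a ^ 4 * (S₁ ^ 2 + S₂ ^ 2 + S₃ ^ 2) = (8 * a ^ 2 - 4 * b ^ 2) * (S₁ * S₂ * S₃) := by
    linear_combination S₁ * S₂ * S₃ * i2
      - S₁ ^ 2 * (m * S₂ * e3 + 4 * a ^ 2 * e2) - S₂ ^ 2 * (n * S₃ * e1 + 4 * a ^ 2 * e3)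
      - S₃ ^ 2 * (l * S₁ * e2 + 4 * a ^ 2 * e1)
  have ha4 : 16 * a ^ 4 ≠ 0 := by positivity
  apply mul_left_cancel₀ ha4
  rw [i5]
  linear_combination 4 * a ^ 2 * s4 + 4 * a ^ 2 * (4 * b ^ 2 - 8 * a ^ 2) * s2

/-- The squared radius of the circumcircle and the power of the center of the ellipse. -/
theorem IsDualWeights.circumradius (hb : 0 < b) (hab : b ≤ a)
    (h : IsDualWeights a b x₁ y₁ x₂ y₂ x₃ y₃ l m n)
    (h₁ : S₁ = (x₂ - x₃) ^ 2 + (y₂ - y₃) ^ 2)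
    (h₂ : S₂ = (x₃ - x₁) ^ 2 + (y₃ - y₁) ^ 2) (h₃ : S₃ = (x₁ - x₂) ^ 2 + (y₁ - y₂) ^ 2)
    (c₁ : (x₁ - p) ^ 2 + (y₁ - q) ^ 2 = ρ) (c₂ : (x₂ - p) ^ 2 + (y₂ - q) ^ 2 = ρ)
    (c₃ : (x₃ - p) ^ 2 + (y₃ - q) ^ 2 = ρ)
    (e₁ : l * S₁ = m * S₂) (e₂ : m * S₂ = n * S₃) :
    ρ * b ^ 2 = 4 * a ^ 4 ∧ ρ - p ^ 2 - q ^ 2 = 5 * a ^ 2 - b ^ 2 ∧ l * S₁ = 4 * a ^ 2 := by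
  have ha : 0 < a := hb.trans_le hab
  have hD := h.area₂_ne_zero ha.ne' hb.ne'
  have p₁ := sq_side_pos h₁ hD
  have p₂ := sq_side_pos h₂ (by rwa [area₂_rotate])
  have p₃ := sq_side_pos h₃ (by rwa [area₂_rotate, area₂_rotate])
  have i1 := h.sum_mul_sq_sides h₁ h₂ h₃ c₁ c₂ c₃
  have i2 := h.sum_sq_sides_mul h₁ h₂ h₃ c₁ c₂ c₃
  have i3 := h.area₂_sq_mul
  have i4 := mul_sq_sides_eq h₁ h₂ h₃ c₁ c₂ c₃
  have i5 := four_mul_area₂_sq h₁ h₂ h₃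
  have hs := h.sum_eq
  have hl := h.pos₁
  obtain ⟨w, hw⟩ : ∃ w, w = ρ - p ^ 2 - q ^ 2 := ⟨_, rfl⟩
  obtain ⟨k, hk⟩ : ∃ k, k = l * S₁ := ⟨_, rfl⟩
  have e1 : l * S₁ = k := hk.symm
  have e2 : m * S₂ = k := by rw [← e₁, hk]
  have e3 : n * S₃ = k := by rw [← e₂, e2]
  have hkpos : 0 < k := hk ▸ mul_pos hl p₁
  rw [← hw] at i1 i2 ⊢
  obtain ⟨P, hP⟩ : ∃ P, P = S₁ * S₂ * S₃ := ⟨_, rfl⟩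
  have hPpos : 0 < P := by rw [hP]; positivity
  have s2 : k * (S₁ * S₂ + S₂ * S₃ + S₃ * S₁) = P := by
    linear_combination S₁ * S₂ * S₃ * hs - S₂ * S₃ * e1 - S₃ * S₁ * e2 - S₁ * S₂ * e3 - hP
  have s4 : k ^ 2 * (S₁ ^ 2 + S₂ ^ 2 + S₃ ^ 2) = (2 * w - 2 * (a ^ 2 + b ^ 2)) * P := by
    linear_combination S₁ * S₂ * S₃ * i2 - (2 * w - 2 * (a ^ 2 + b ^ 2)) * hP
      - S₁ ^ 2 * (m * S₂ * e3 + k * e2) - S₂ ^ 2 * (n * S₃ * e1 + k * e3)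
      - S₃ ^ 2 * (l * S₁ * e2 + k * e1)
  have k1 : 3 * k = 2 * (a ^ 2 + b ^ 2 + w) := by linear_combination i1 - e1 - e2 - e3
  have k3 : k ^ 3 = 16 * ρ * (a ^ 2 * b ^ 2) := by
    linear_combination l * m * n * i4 + 4 * ρ * i3 - m * S₂ * n * S₃ * e1 - k * n * S₃ * e2
      - k ^ 2 * e3
  have k2 : k ^ 2 = ρ * (4 * (a ^ 2 + b ^ 2) - k) := by
    apply mul_left_cancel₀ hPpos.ne'
    linear_combination k ^ 2 * hP + k ^ 2 * i4 + ρ * k ^ 2 * i5 + ρ * (2 * k * s2 - s4)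
      + ρ * P * k1
  have hρ : ρ ≠ 0 := by
    rintro rfl
    have : k ^ 3 = 0 := by rw [k3]; ring
    exact hkpos.ne' (by simpa using this)
  have kq : (k - 4 * a ^ 2) * (k - 4 * b ^ 2) = 0 := by
    apply mul_left_cancel₀ hρ
    linear_combination k * k2 - k3
  have kge : 2 * (a ^ 2 + b ^ 2) ≤ k := by
    have t : S₁ * S₂ + S₂ * S₃ + S₃ * S₁ ≤ S₁ ^ 2 + S₂ ^ 2 + S₃ ^ 2 := by
      linarith [sq_nonneg (S₁ - S₂), sq_nonneg (S₂ - S₃), sq_nonneg (S₃ - S₁)]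
    have t2 : k * P ≤ (2 * w - 2 * (a ^ 2 + b ^ 2)) * P := by
      rw [← s4, ← s2, ← mul_assoc, ← pow_two]
      exact mul_le_mul_of_nonneg_left t (sq_nonneg k)
    have := le_of_mul_le_mul_right t2 hPpos
    linarith
  have hk4 : k = 4 * a ^ 2 := by
    rcases mul_eq_zero.1 kq with h | h
    · linarith
    · have := pow_le_pow_left₀ hb.le hab 2
      linarith
  have hwv : w = 5 * a ^ 2 - b ^ 2 := by linarith
  have hρv : ρ * b ^ 2 = 4 * a ^ 4 := by
    have : 16 * a ^ 2 ≠ 0 := by positivity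
    apply mul_left_cancel₀ this
    rw [hk4] at k3
    linear_combination -k3
  exact ⟨hρv, hwv, hk4 ▸ e1⟩

/-- The circumcenter lies on the minor axis of the ellipse. -/
theorem IsDualWeights.circumcenter (hb : 0 < b) (hab : b ≤ a)
    (h : IsDualWeights a b x₁ y₁ x₂ y₂ x₃ y₃ l m n)
    (h₁ : S₁ = (x₂ - x₃) ^ 2 + (y₂ - y₃) ^ 2)
    (h₂ : S₂ = (x₃ - x₁) ^ 2 + (y₃ - y₁) ^ 2) (h₃ : S₃ = (x₁ - x₂) ^ 2 + (y₁ - y₂) ^ 2)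
    (c₁ : (x₁ - p) ^ 2 + (y₁ - q) ^ 2 = ρ) (c₂ : (x₂ - p) ^ 2 + (y₂ - q) ^ 2 = ρ)
    (c₃ : (x₃ - p) ^ 2 + (y₃ - q) ^ 2 = ρ) (hρ : ρ * b ^ 2 = 4 * a ^ 4)
    (hw : ρ - p ^ 2 - q ^ 2 = 5 * a ^ 2 - b ^ 2)
    (e1 : l * S₁ = 4 * a ^ 2) (e2 : m * S₂ = 4 * a ^ 2) (e3 : n * S₃ = 4 * a ^ 2) : p = 0 := by
  have ha : 0 < a := hb.trans_le hab
  have hD := h.area₂_ne_zero ha.ne' hb.ne'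
  have p₁ := sq_side_pos h₁ hD
  have p₂ := sq_side_pos h₂ (by rwa [area₂_rotate])
  have p₃ := sq_side_pos h₃ (by rwa [area₂_rotate, area₂_rotate])
  have i2 := h.sum_sq_sides_mul h₁ h₂ h₃ c₁ c₂ c₃
  have f1 := h.inner_circumcenter h₂ h₃ c₁ c₂ c₃
  have f2 := h.rotate.inner_circumcenter h₃ h₁ c₂ c₃ c₁
  have f3 := h.rotate.rotate.inner_circumcenter h₁ h₂ c₃ c₁ c₂
  obtain ⟨-, -, -, hs, -, -, hxx, hyy, hxy⟩ := h
  rw [hw] at f1 f2 f3 i2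
  clear h₁ h₂ h₃ c₁ c₂ c₃ hD
  obtain ⟨k, hk⟩ : ∃ k, k = 4 * a ^ 2 := ⟨_, rfl⟩
  rw [← hk] at e1 e2 e3
  obtain ⟨σ, hσ⟩ : ∃ σ, σ = S₁ + S₂ + S₃ := ⟨_, rfl⟩
  obtain ⟨P, hP⟩ : ∃ P, P = S₁ * S₂ * S₃ := ⟨_, rfl⟩
  have hPpos : 0 < P := by rw [hP]; positivity
  obtain ⟨A, hA⟩ : ∃ A, A = 4 * b ^ 2 - 16 * a ^ 2 := ⟨_, rfl⟩
  have g1 : 4 * (p * x₁ + q * y₁) = A + σ * l := by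
    linear_combination f1 + e2 + e3 - e1 - l * hσ - hA + hk
  have g2 : 4 * (p * x₂ + q * y₂) = A + σ * m := by
    linear_combination f2 + e3 + e1 - e2 - m * hσ - hA + hk
  have g3 : 4 * (p * x₃ + q * y₃) = A + σ * n := by
    linear_combination f3 + e1 + e2 - e3 - n * hσ - hA + hk
  have E2 : P * (l * m + m * n + n * l) = k ^ 2 * σ := by
    rw [hP, hσ]
    linear_combination S₃ * (m * S₂ * e1 + k * e2) + S₁ * (n * S₃ * e2 + k * e3)
      + S₂ * (l * S₁ * e3 + k * e1)
  have E3 : P * (l * m * n) = k ^ 3 := by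
    rw [hP]; linear_combination m * S₂ * n * S₃ * e1 + k * n * S₃ * e2 + k ^ 2 * e3
  have s2 : k * (S₁ * S₂ + S₂ * S₃ + S₃ * S₁) = P := by
    linear_combination S₁ * S₂ * S₃ * hs - S₂ * S₃ * e1 - S₃ * S₁ * e2 - S₁ * S₂ * e3 - hP
  have s4 : k ^ 2 * (S₁ ^ 2 + S₂ ^ 2 + S₃ ^ 2) = (8 * a ^ 2 - 4 * b ^ 2) * P := by
    linear_combination S₁ * S₂ * S₃ * i2 - (8 * a ^ 2 - 4 * b ^ 2) * hP
      - S₁ ^ 2 * (m * S₂ * e3 + k * e2) - S₂ ^ 2 * (n * S₃ * e1 + k * e3)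
      - S₃ ^ 2 * (l * S₁ * e2 + k * e1)
  have hσ2 : k ^ 2 * σ ^ 2 = -A * P := by
    rw [hσ]; linear_combination s4 + 2 * k * s2 + P * hA + 2 * P * hk
  have tot : n * (4 * (p * x₁ + q * y₁)) * (4 * (p * x₂ + q * y₂))
      + m * (4 * (p * x₁ + q * y₁)) * (4 * (p * x₃ + q * y₃))
      + l * (4 * (p * x₂ + q * y₂)) * (4 * (p * x₃ + q * y₃))
      = -16 * (a ^ 2 * p ^ 2 + b ^ 2 * q ^ 2) := by
    linear_combination 16 * p ^ 2 * hxx + 16 * q ^ 2 * hyy + 16 * p * q * hxy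
  rw [g1, g2, g3] at tot
  have quad : 16 * (a ^ 2 * p ^ 2 + b ^ 2 * q ^ 2) = A * (A + 3 * k) := by
    apply mul_left_cancel₀ hPpos.ne'
    linear_combination P * tot - P * A ^ 2 * hs - 2 * A * σ * E2 - 3 * σ ^ 2 * E3
      - (2 * A + 3 * k) * hσ2
  have hp : (a ^ 2 - b ^ 2) * p ^ 2 = 0 := by
    rw [hA, hk] at quad
    linear_combination quad / 16 - hρ + b ^ 2 * hw
  rcases mul_eq_zero.1 hp with h0 | h0
  · have hb2 : b ^ 2 ≠ 0 := by positivity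
    have hρ' : ρ = 4 * a ^ 2 := by
      apply mul_right_cancel₀ hb2
      linear_combination hρ + 4 * a ^ 2 * h0
    have : p ^ 2 ≤ 0 := by linarith [sq_nonneg q]
    simpa using le_antisymm this (sq_nonneg p)
  · simpa using h0

end Invariants

theorem plane_ext {P Q : Plane} (h₀ : P 0 = Q 0) (h₁ : P 1 = Q 1) : P = Q := by
  ext i; fin_cases i
  · exact h₀
  · exact h₁

theorem dist_sq_eq (P Q : Plane) : dist P Q ^ 2 = (P 0 - Q 0) ^ 2 + (P 1 - Q 1) ^ 2 := by
  rw [EuclideanSpace.dist_eq, Real.sq_sqrt (by positivity), Fin.sum_univ_two, Real.dist_eq,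
    Real.dist_eq, sq_abs, sq_abs]

theorem lineMap_apply (P Q : Plane) (t : ℝ) (i : Fin 2) :
    AffineMap.lineMap P Q t i = (1 - t) * P i + t * Q i := by
  simp [AffineMap.lineMap_apply]; ring

/-- An angle in the plane through the dot and cross products of its legs. -/
theorem angle_eq_pi_div_two_sub_arctan (X P Q : Plane) {d c : ℝ}
    (hd : d = (X 0 - P 0) * (Q 0 - P 0) + (X 1 - P 1) * (Q 1 - P 1))
    (hc : c ^ 2 = ((X 0 - P 0) * (Q 1 - P 1) - (X 1 - P 1) * (Q 0 - P 0)) ^ 2) (hpos : 0 < c) :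
    ∠ X P Q = Real.pi / 2 - Real.arctan (d / c) := by
  have hin : inner ℝ (X -ᵥ P) (Q -ᵥ P) = d := by
    rw [hd]; simp [PiLp.inner_apply, Fin.sum_univ_two]; ring
  have hn : ‖X -ᵥ P‖ * ‖Q -ᵥ P‖ = √(d ^ 2 + c ^ 2) := by
    have hX := dist_sq_eq X P
    have hQ := dist_sq_eq Q P
    rw [← dist_eq_norm_vsub, ← dist_eq_norm_vsub,
      ← Real.sqrt_sq (by positivity : 0 ≤ dist X P * dist Q P), mul_pow, hX, hQ, hc, hd]
    congr 1
    ring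
  rw [EuclideanGeometry.angle, InnerProductGeometry.angle, Real.arctan_eq_arcsin,
    Real.arccos_eq_pi_div_two_sub_arcsin, hin, hn]
  congr 2
  have : 1 + (d / c) ^ 2 = (d ^ 2 + c ^ 2) / c ^ 2 := by field_simp; ring
  rw [this, Real.sqrt_div (by positivity), Real.sqrt_sq hpos.le]
  have : 0 < √(d ^ 2 + c ^ 2) := by positivity
  field_simp

theorem mem_interior_iff {T : PlaneTriangle} {Ω : Plane} : Ω ∈ T.interior ↔ ∃ u v w : ℝ,
    0 < u ∧ 0 < v ∧ 0 < w ∧ u + v + w = 1 ∧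
      ∀ i, Ω i = u * T.points 0 i + v * T.points 1 i + w * T.points 2 i := by
  constructor
  · rintro ⟨w, hw, hpos, rfl⟩
    refine ⟨w 0, w 1, w 2, (hpos 0).1, (hpos 1).1, (hpos 2).1, by
      rw [← hw, Fin.sum_univ_three], fun i => ?_⟩
    rw [Finset.univ.affineCombination_eq_linear_combination _ _ hw]
    simp [Fin.sum_univ_three]
  · rintro ⟨u, v, w, hu, hv, hw, hs, h⟩
    have hsum : ∑ i, ![u, v, w] i = 1 := by simpa [Fin.sum_univ_three] using hs
    refine ⟨![u, v, w], hsum, ?_, ?_⟩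
    · intro i; fin_cases i <;> simp <;> constructor <;> linarith
    · ext i
      rw [Finset.univ.affineCombination_eq_linear_combination _ _ hsum, h]
      simp [Fin.sum_univ_three]

theorem area₂_ne_zero (T : PlaneTriangle) : area₂ (T.points 0 0) (T.points 0 1) (T.points 1 0)
    (T.points 1 1) (T.points 2 0) (T.points 2 1) ≠ 0 := by
  intro h
  rw [area₂] at h
  have key : ∀ u v w : ℝ, u + v + w = 0 →
      (∀ i, u * T.points 0 i + v * T.points 1 i + w * T.points 2 i = 0) → u = 0 ∧ v = 0 ∧ w = 0 := by
    intro u v w hs hi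
    have := affineIndependent_iff.1 T.independent Finset.univ ![u, v, w]
      (by simpa [Fin.sum_univ_three] using hs)
      (by ext i; simpa [Fin.sum_univ_three] using hi i)
    exact ⟨this 0 (by simp), this 1 (by simp), this 2 (by simp)⟩
  have hy := key (T.points 1 1 - T.points 2 1) (T.points 2 1 - T.points 0 1)
    (T.points 0 1 - T.points 1 1) (by ring) (by
      intro i; fin_cases i
      · simp; linear_combination h
      · simp; ring)
  have hx := key (T.points 1 0 - T.points 2 0) (T.points 2 0 - T.points 0 0)
    (T.points 0 0 - T.points 1 0) (by ring) (by
      intro i; fin_cases i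
      · simp; ring
      · simp; linear_combination -h)
  have := key 1 (-1) 0 (by ring) (by
    intro i; fin_cases i
    · simp; linear_combination hx.2.2
    · simp; linear_combination hy.2.2)
  exact one_ne_zero this.1

theorem affineIndependent_of_area₂_ne_zero {P : Fin 3 → Plane}
    (h : area₂ (P 0 0) (P 0 1) (P 1 0) (P 1 1) (P 2 0) (P 2 1) ≠ 0) : AffineIndependent ℝ P := by
  rw [affineIndependent_iff_of_fintype]
  intro w hw hs
  rw [Finset.univ.weightedVSub_eq_linear_combination hw] at hs
  have h0 := congrArg (fun v : Plane => v 0) hs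
  have h1 := congrArg (fun v : Plane => v 1) hs
  simp only [Fin.sum_univ_three, PiLp.add_apply, PiLp.smul_apply, PiLp.zero_apply,
    smul_eq_mul] at h0 h1 hw
  rw [area₂] at h
  have w0 : w 0 = 0 := by
    apply mul_right_cancel₀ h
    linear_combination (P 1 1 - P 2 1) * h0 - (P 1 0 - P 2 0) * h1
      + (P 1 0 * P 2 1 - P 2 0 * P 1 1) * hw
  have w1 : w 1 = 0 := by
    apply mul_right_cancel₀ h
    linear_combination (P 2 1 - P 0 1) * h0 - (P 2 0 - P 0 0) * h1
      + (P 2 0 * P 0 1 - P 0 0 * P 2 1) * hw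
  have w2 : w 2 = 0 := by linarith
  intro i
  fin_cases i
  exacts [w0, w1, w2]

section Angle

variable {A B C Ω : Plane} {u v w Δ σ : ℝ}

theorem brocard_angles (hΩ : ∀ i, Ω i = u * A i + v * B i + w * C i) (hu : 0 < u) (hv : 0 < v)
    (hw : 0 < w) (hs : u + v + w = 1) (hΔ : 0 < Δ)
    (hΔ2 : Δ ^ 2 = area₂ (A 0) (A 1) (B 0) (B 1) (C 0) (C 1) ^ 2) :
    ∠ Ω A B = Real.pi / 2 - Real.arctan
        (((Ω 0 - A 0) * (B 0 - A 0) + (Ω 1 - A 1) * (B 1 - A 1)) / (w * Δ)) ∧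
      ∠ Ω B C = Real.pi / 2 - Real.arctan
        (((Ω 0 - B 0) * (C 0 - B 0) + (Ω 1 - B 1) * (C 1 - B 1)) / (u * Δ)) ∧
      ∠ Ω C A = Real.pi / 2 - Real.arctan
        (((Ω 0 - C 0) * (A 0 - C 0) + (Ω 1 - C 1) * (A 1 - C 1)) / (v * Δ)) := by
  refine ⟨angle_eq_pi_div_two_sub_arctan _ _ _ rfl ?_ (by positivity),
    angle_eq_pi_div_two_sub_arctan _ _ _ rfl ?_ (by positivity),
    angle_eq_pi_div_two_sub_arctan _ _ _ rfl ?_ (by positivity)⟩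
  · rw [mul_pow, hΔ2, area₂, hΩ, hΩ, ← mul_pow, ← neg_sq]
    congr 1
    obtain rfl : u = 1 - v - w := by linarith
    ring
  · rw [mul_pow, hΔ2, area₂, hΩ, hΩ, ← mul_pow, ← neg_sq]
    congr 1
    obtain rfl : v = 1 - u - w := by linarith
    ring
  · rw [mul_pow, hΔ2, area₂, hΩ, hΩ, ← mul_pow, ← neg_sq]
    congr 1
    obtain rfl : w = 1 - u - v := by linarith
    ring

theorem eq_of_brocard_angles (hΩ : ∀ i, Ω i = u * A i + v * B i + w * C i) (hu : 0 < u)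
    (hv : 0 < v) (hw : 0 < w) (hs : u + v + w = 1) (hΔ : 0 < Δ)
    (hΔ2 : Δ ^ 2 = area₂ (A 0) (A 1) (B 0) (B 1) (C 0) (C 1) ^ 2)
    (hσ : σ = dist B C ^ 2 + dist C A ^ 2 + dist A B ^ 2) {ω : ℝ}
    (h₁ : ∠ Ω A B = ω) (h₂ : ∠ Ω B C = ω) (h₃ : ∠ Ω C A = ω) :
    ω = Real.pi / 2 - Real.arctan (σ / (2 * Δ)) := by
  obtain ⟨e₁, e₂, e₃⟩ := brocard_angles hΩ hu hv hw hs hΔ hΔ2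
  rw [dist_sq_eq, dist_sq_eq, dist_sq_eq] at hσ
  obtain ⟨κ, hκ⟩ : ∃ κ, κ = Real.tan (Real.pi / 2 - ω) := ⟨_, rfl⟩
  have aux : ∀ {d c : ℝ}, 0 < c → ω = Real.pi / 2 - Real.arctan (d / c) → d = κ * c := by
    intro d c hc h
    rw [hκ, h, sub_sub_cancel, Real.tan_arctan, div_mul_cancel₀ _ hc.ne']
  have f₁ := aux (by positivity) (h₁.symm.trans e₁)
  have f₂ := aux (by positivity) (h₂.symm.trans e₂)
  have f₃ := aux (by positivity) (h₃.symm.trans e₃)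
  have hd : σ / (2 * Δ) =
      ((Ω 0 - A 0) * (B 0 - A 0) + (Ω 1 - A 1) * (B 1 - A 1)) / (w * Δ) := by
    rw [f₁, div_eq_div_iff (by positivity) (by positivity)]
    have : σ = 2 * (κ * Δ) := by
      linear_combination hσ + 2 * (f₁ + f₂ + f₃) + 2 * κ * Δ * hs
    rw [this]; ring
  rw [hd, ← e₁, h₁]

theorem exists_brocard_angles (hΔ : 0 < Δ)
    (hΔ2 : Δ ^ 2 = area₂ (A 0) (A 1) (B 0) (B 1) (C 0) (C 1) ^ 2)
    (hσ : σ = dist B C ^ 2 + dist C A ^ 2 + dist A B ^ 2) :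
    ∃ u v w : ℝ, 0 < u ∧ 0 < v ∧ 0 < w ∧ u + v + w = 1 ∧
      ∀ Ω : Plane, (∀ i, Ω i = u * A i + v * B i + w * C i) →
        ∠ Ω A B = Real.pi / 2 - Real.arctan (σ / (2 * Δ)) ∧
        ∠ Ω B C = Real.pi / 2 - Real.arctan (σ / (2 * Δ)) ∧
        ∠ Ω C A = Real.pi / 2 - Real.arctan (σ / (2 * Δ)) := by
  have hD : area₂ (A 0) (A 1) (B 0) (B 1) (C 0) (C 1) ≠ 0 := by
    intro h
    rw [h] at hΔ2
    simp [hΔ.ne'] at hΔ2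
  obtain ⟨S₁, h₁⟩ : ∃ S, S = dist B C ^ 2 := ⟨_, rfl⟩
  obtain ⟨S₂, h₂⟩ : ∃ S, S = dist C A ^ 2 := ⟨_, rfl⟩
  obtain ⟨S₃, h₃⟩ : ∃ S, S = dist A B ^ 2 := ⟨_, rfl⟩
  rw [← h₁, ← h₂, ← h₃] at hσ
  rw [dist_sq_eq] at h₁ h₂ h₃
  have p₁ := sq_side_pos h₁ hD
  have p₂ := sq_side_pos h₂ (by rwa [area₂_rotate])
  have p₃ := sq_side_pos h₃ (by rwa [area₂_rotate, area₂_rotate])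
  obtain ⟨N, hN⟩ : ∃ N, N = S₁ * S₂ + S₂ * S₃ + S₃ * S₁ := ⟨_, rfl⟩
  have hNpos : 0 < N := by rw [hN]; positivity
  obtain ⟨u, hu⟩ : ∃ u, u = S₃ * S₁ / N := ⟨_, rfl⟩
  obtain ⟨v, hv⟩ : ∃ v, v = S₁ * S₂ / N := ⟨_, rfl⟩
  obtain ⟨w, hw⟩ : ∃ w, w = S₂ * S₃ / N := ⟨_, rfl⟩
  have pu : 0 < u := by rw [hu]; positivity
  have pv : 0 < v := by rw [hv]; positivity
  have pw : 0 < w := by rw [hw]; positivity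
  have hs : u + v + w = 1 := by
    rw [hu, hv, hw, ← add_div, ← add_div, div_eq_one_iff_eq hNpos.ne', hN]; ring
  have r₁ : v * S₃ = w * S₁ := by rw [hv, hw]; ring
  have r₂ : w * S₁ = u * S₂ := by rw [hw, hu]; ring
  refine ⟨u, v, w, pu, pv, pw, hs, fun Ω hΩ => ?_⟩
  obtain ⟨e₁, e₂, e₃⟩ := brocard_angles hΩ pu pv pw hs hΔ hΔ2
  rw [e₁, e₂, e₃, hΩ, hΩ]
  obtain rfl : u = 1 - v - w := by linarith
  refine ⟨?_, ?_, ?_⟩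
  · congr 2
    rw [div_eq_div_iff (by positivity) (by positivity)]
    linear_combination 2 * Δ * (r₁ - v * h₃ - w * (h₂ + h₃ - h₁) / 2) - w * Δ * hσ
  · congr 2
    rw [div_eq_div_iff (by positivity) (by positivity)]
    linear_combination 2 * Δ * (r₂ - w * h₁ - (1 - v - w) * (h₁ + h₃ - h₂) / 2)
      - (1 - v - w) * Δ * hσ
  · congr 2
    rw [div_eq_div_iff (by positivity) (by positivity)]
    linear_combination 2 * Δ * (-r₁ - r₂ - (1 - v - w) * h₂ - v * (h₁ + h₂ - h₃) / 2)
      - v * Δ * hσ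

end Angle

/-- Every triangle has a unique Brocard angle, given by `cot ω = (s₁² + s₂² + s₃²) / (4 area)`. -/
theorem isBrocardAngle_iff (T : PlaneTriangle) {Δ σ ω : ℝ} (hΔ : 0 < Δ)
    (hΔ2 : Δ ^ 2 = area₂ (T.points 0 0) (T.points 0 1) (T.points 1 0)
      (T.points 1 1) (T.points 2 0) (T.points 2 1) ^ 2)
    (hσ : σ = dist (T.points 1) (T.points 2) ^ 2 + dist (T.points 2) (T.points 0) ^ 2
      + dist (T.points 0) (T.points 1) ^ 2) :
    IsBrocardAngle T ω ↔ ω = Real.pi / 2 - Real.arctan (σ / (2 * Δ)) := by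
  constructor
  · rintro ⟨⟨Ω, hΩ, h⟩, -⟩
    obtain ⟨u, v, w, hu, hv, hw, hs, hi⟩ := mem_interior_iff.1 hΩ
    exact eq_of_brocard_angles hi hu hv hw hs hΔ hΔ2 hσ (h 0) (h 1) (h 2)
  · rintro rfl
    constructor
    · obtain ⟨u, v, w, hu, hv, hw, hs, h⟩ := exists_brocard_angles hΔ hΔ2 hσ
      obtain ⟨Ω, hΩ⟩ : ∃ Ω : Plane, ∀ i,
          Ω i = u * T.points 0 i + v * T.points 1 i + w * T.points 2 i :=
        ⟨WithLp.toLp 2 fun i => _, fun i => rfl⟩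
      refine ⟨Ω, mem_interior_iff.2 ⟨u, v, w, hu, hv, hw, hs, hΩ⟩, fun i => ?_⟩
      obtain ⟨e₁, e₂, e₃⟩ := h Ω hΩ
      fin_cases i
      exacts [e₁, e₂, e₃]
    · have hΔ' : Δ ^ 2 = area₂ (T.points 0 0) (T.points 0 1) (T.points 2 0)
          (T.points 2 1) (T.points 1 0) (T.points 1 1) ^ 2 := by
        rw [hΔ2, area₂, area₂]; ring
      have hσ' : σ = dist (T.points 2) (T.points 1) ^ 2 + dist (T.points 1) (T.points 0) ^ 2
          + dist (T.points 0) (T.points 2) ^ 2 := by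
        rw [hσ, dist_comm (T.points 2) (T.points 1), dist_comm (T.points 1) (T.points 0),
          dist_comm (T.points 0) (T.points 2)]
        ring
      obtain ⟨u, v, w, hu, hv, hw, hs, h⟩ := exists_brocard_angles hΔ hΔ' hσ'
      obtain ⟨Ω, hΩ⟩ : ∃ Ω : Plane, ∀ i,
          Ω i = u * T.points 0 i + v * T.points 2 i + w * T.points 1 i :=
        ⟨WithLp.toLp 2 fun i => _, fun i => rfl⟩
      refine ⟨Ω, mem_interior_iff.2 ⟨u, w, v, hu, hw, hv, by linarith, fun i => ?_⟩, fun i => ?_⟩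
      · rw [hΩ]; ring
      obtain ⟨e₁, e₂, e₃⟩ := h Ω hΩ
      fin_cases i
      exacts [e₁, e₃, e₂]

theorem mem_ellipse {a b : ℝ} {P : Plane} :
    P ∈ ellipse a b ↔ P 0 ^ 2 / a ^ 2 + P 1 ^ 2 / b ^ 2 = 1 := Iff.rfl

/-- A segment of positive length has positive length in the metric of the ellipse. -/
theorem ellipse_form_pos {a b : ℝ} (ha : a ≠ 0) (hb : b ≠ 0) {P Q : Plane} (h : P ≠ Q) :
    0 < (Q 0 - P 0) ^ 2 / a ^ 2 + (Q 1 - P 1) ^ 2 / b ^ 2 := by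
  by_contra! h0
  have h1 : 0 ≤ (Q 0 - P 0) ^ 2 / a ^ 2 := by positivity
  have h2 : 0 ≤ (Q 1 - P 1) ^ 2 / b ^ 2 := by positivity
  have e1 : (Q 0 - P 0) ^ 2 / a ^ 2 = 0 := by linarith
  have e2 : (Q 1 - P 1) ^ 2 / b ^ 2 = 0 := by linarith
  rw [div_eq_zero_iff, or_iff_left (by positivity), sq_eq_zero_iff, sub_eq_zero] at e1 e2
  exact h (plane_ext e1.symm e2.symm)

theorem exists_isTouchRatio {a b : ℝ} (ha : a ≠ 0) (hb : b ≠ 0) {P Q p : Plane}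
    (h : ellipse a b ∩ (line[ℝ, P, Q] : Set Plane) = {p}) (hs : Sbtw ℝ P p Q) :
    ∃ t, IsTouchRatio a b (P 0) (P 1) (Q 0) (Q 1) t ∧ ∀ i, p i = (1 - t) * P i + t * Q i := by
  obtain ⟨t, ⟨h0, h1⟩, rfl⟩ := hs.mem_image_Ioo
  have hpos := ellipse_form_pos ha hb hs.left_ne_right
  obtain ⟨E, hE⟩ : ∃ E, E = (Q 0 - P 0) ^ 2 / a ^ 2 + (Q 1 - P 1) ^ 2 / b ^ 2 := ⟨_, rfl⟩
  rw [← hE] at hpos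
  have hp : AffineMap.lineMap P Q t ∈ ellipse a b :=
    (h.ge (Set.mem_singleton _)).1
  rw [mem_ellipse, lineMap_apply, lineMap_apply] at hp
  obtain ⟨F, hF⟩ : ∃ F, F = (Q 0 - P 0) * ((1 - t) * P 0 + t * Q 0) / a ^ 2
    + (Q 1 - P 1) * ((1 - t) * P 1 + t * Q 1) / b ^ 2 := ⟨_, rfl⟩
  obtain ⟨s, hs⟩ : ∃ s, s * E = -2 * F := ⟨-2 * F / E, by field_simp⟩
  have hmem : AffineMap.lineMap P Q (t + s) ∈ ellipse a b ∩ (line[ℝ, P, Q] : Set Plane) := by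
    refine ⟨?_, AffineMap.lineMap_mem_affineSpan_pair _ _ _⟩
    rw [mem_ellipse, lineMap_apply, lineMap_apply]
    linear_combination hp + s * hs - 2 * s * hF - s ^ 2 * hE
  rw [h, Set.mem_singleton_iff] at hmem
  have m0 := congrArg (fun v : Plane => v 0) hmem
  have m1 := congrArg (fun v : Plane => v 1) hmem
  simp only [lineMap_apply] at m0 m1
  have hF0 : F = 0 := by
    linear_combination hs / 2 - s / 2 * hE - (Q 0 - P 0) / a ^ 2 / 2 * m0
      - (Q 1 - P 1) / b ^ 2 / 2 * m1
  rw [hF0] at hF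
  refine ⟨t, ⟨h0, h1, ?_, ?_⟩, lineMap_apply P Q t⟩
  · linear_combination hp + t * hF
  · linear_combination hp - (1 - t) * hF

theorem IsTouchRatio.touches {a b t : ℝ} (ha : a ≠ 0) (hb : b ≠ 0) {P Q : Plane} (hPQ : P ≠ Q)
    (h : IsTouchRatio a b (P 0) (P 1) (Q 0) (Q 1) t) :
    ellipse a b ∩ (line[ℝ, P, Q] : Set Plane) = {AffineMap.lineMap P Q t} ∧
      Sbtw ℝ P (AffineMap.lineMap P Q t) Q := by
  have hpos := ellipse_form_pos ha hb hPQ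
  obtain ⟨h0, h1, hl, hr⟩ := h
  refine ⟨?_, sbtw_lineMap_iff.2 ⟨hPQ, h0, h1⟩⟩
  ext z
  rw [Set.mem_singleton_iff]
  constructor
  · rintro ⟨hz, hz'⟩
    obtain ⟨s, rfl⟩ := mem_affineSpan_pair_iff_exists_lineMap_eq.1 hz'
    rw [mem_ellipse, lineMap_apply, lineMap_apply] at hz
    have : (s - t) ^ 2 * ((Q 0 - P 0) ^ 2 / a ^ 2 + (Q 1 - P 1) ^ 2 / b ^ 2) = 0 := by
      linear_combination hz - (1 - t + 2 * (t - s)) * hl - (t - 2 * (t - s)) * hr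
    rcases mul_eq_zero.1 this with h | h
    · rw [sub_eq_zero.1 (sq_eq_zero_iff.1 h)]
    · exact absurd h hpos.ne'
  · rintro rfl
    refine ⟨?_, AffineMap.lineMap_mem_affineSpan_pair _ _ _⟩
    rw [mem_ellipse, lineMap_apply, lineMap_apply]
    linear_combination (1 - t) * hl + t * hr

theorem sum_fin_three (f : Fin 3 → ℝ) (i : Fin 3) : ∑ j, f j = f i + f (i + 1) + f (i + 2) := by
  rw [Fin.sum_univ_three]
  fin_cases i
  · rfl
  · change _ = f 1 + f 2 + f 0; ring
  · change _ = f 2 + f 0 + f 1; ring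

theorem barycentricPoint_apply (T : PlaneTriangle) (w : Fin 3 → ℝ) (i : Fin 3) (k : Fin 2) :
    barycentricPoint T w k = (w i + w (i + 1) + w (i + 2))⁻¹ *
      (w i * T.points i k + w (i + 1) * T.points (i + 1) k + w (i + 2) * T.points (i + 2) k) := by
  rw [← sum_fin_three w i, ← sum_fin_three (fun j => w j * T.points j k) i, barycentricPoint]
  simp

theorem sideLength_pos (T : PlaneTriangle) (i : Fin 3) : 0 < sideLength T i := by
  rw [sideLength, dist_pos]
  exact fun h => by simpa using T.independent.injective h

theorem points_succ_ne (T : PlaneTriangle) (i : Fin 3) : T.points (i + 1) ≠ T.points (i + 2) :=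
  fun h => by simpa using T.independent.injective h

/-- A touch point on the symmedian from the opposite vertex. -/
theorem exists_touch_on_symmedian {a b : ℝ} (ha : a ≠ 0) (hb : b ≠ 0) (T : PlaneTriangle)
    (i : Fin 3)
    (h : IsTouchRatio a b (T.points (i + 1) 0) (T.points (i + 1) 1) (T.points (i + 2) 0)
      (T.points (i + 2) 1)
      (sideLength T (i + 2) ^ 2 / (sideLength T (i + 1) ^ 2 + sideLength T (i + 2) ^ 2))) :
    ∃ p, SideTouchesAt T a b i p ∧ p ∈ line[ℝ, T.points i, symmedianPoint T] := by
  refine ⟨_, h.touches ha hb (points_succ_ne T i), ?_⟩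
  have p0 := sideLength_pos T i
  have p1 := sideLength_pos T (i + 1)
  have p2 := sideLength_pos T (i + 2)
  rw [mem_affineSpan_pair_iff_exists_lineMap_eq]
  refine ⟨(sideLength T i ^ 2 + sideLength T (i + 1) ^ 2 + sideLength T (i + 2) ^ 2)
    / (sideLength T (i + 1) ^ 2 + sideLength T (i + 2) ^ 2), ?_⟩
  ext k
  rw [lineMap_apply, lineMap_apply, symmedianPoint, barycentricPoint_apply T _ i]
  field_simp
  ring

theorem symmedian_ratio (T : PlaneTriangle) (i : Fin 3) {p : Plane} {t : ℝ}
    (hD : area₂ (T.points i 0) (T.points i 1) (T.points (i + 1) 0) (T.points (i + 1) 1)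
      (T.points (i + 2) 0) (T.points (i + 2) 1) ≠ 0)
    (hp : p ∈ line[ℝ, T.points i, symmedianPoint T])
    (ht : ∀ k, p k = (1 - t) * T.points (i + 1) k + t * T.points (i + 2) k) :
    (1 - t) * sideLength T (i + 2) ^ 2 = t * sideLength T (i + 1) ^ 2 := by
  obtain ⟨r, rfl⟩ := mem_affineSpan_pair_iff_exists_lineMap_eq.1 hp
  have p0 := sideLength_pos T i
  have p1 := sideLength_pos T (i + 1)
  have p2 := sideLength_pos T (i + 2)
  have h0 := ht 0
  have h1 := ht 1
  rw [lineMap_apply, symmedianPoint, barycentricPoint_apply T _ i] at h0 h1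
  rw [area₂] at hD
  set A := T.points i
  set B := T.points (i + 1)
  set C := T.points (i + 2)
  obtain ⟨S₁, hS₁⟩ : ∃ S, S = sideLength T i ^ 2 := ⟨_, rfl⟩
  obtain ⟨S₂, hS₂⟩ : ∃ S, S = sideLength T (i + 1) ^ 2 := ⟨_, rfl⟩
  obtain ⟨S₃, hS₃⟩ : ∃ S, S = sideLength T (i + 2) ^ 2 := ⟨_, rfl⟩
  obtain ⟨σ, hσ⟩ : ∃ σ, σ = S₁ + S₂ + S₃ := ⟨_, rfl⟩
  have hσpos : 0 < σ := by rw [hσ, hS₁, hS₂, hS₃]; positivity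
  simp only [← hS₁, ← hS₂, ← hS₃, ← hσ] at h0 h1 ⊢
  obtain ⟨r', hr⟩ : ∃ r', r' = r * σ⁻¹ := ⟨_, rfl⟩
  have hr' : r = r' * σ := by rw [hr]; field_simp
  have g0 : (r' * S₂ - (1 - t)) * (B 0 - A 0) + (r' * S₃ - t) * (C 0 - A 0) = 0 := by
    rw [← mul_assoc, ← hr] at h0
    linear_combination h0 + A 0 * hr' + A 0 * r' * hσ
  have g1 : (r' * S₂ - (1 - t)) * (B 1 - A 1) + (r' * S₃ - t) * (C 1 - A 1) = 0 := by
    rw [← mul_assoc, ← hr] at h1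
    linear_combination h1 + A 1 * hr' + A 1 * r' * hσ
  have q1 : r' * S₂ - (1 - t) = 0 := by
    apply mul_right_cancel₀ hD
    linear_combination (C 1 - A 1) * g0 - (C 0 - A 0) * g1
  have q2 : r' * S₃ - t = 0 := by
    apply mul_right_cancel₀ hD
    linear_combination (B 0 - A 0) * g1 - (B 1 - A 1) * g0
  linear_combination S₂ * q2 - S₃ * q1

theorem cot_pi_div_two_sub_arctan (x : ℝ) : Real.cot (Real.pi / 2 - Real.arctan x) = x := by
  rw [Real.cot_eq_cos_div_sin, Real.cos_pi_div_two_sub, Real.sin_pi_div_two_sub,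
    ← Real.tan_eq_sin_div_cos, Real.tan_arctan]

theorem sideLength_sq (T : PlaneTriangle) (i : Fin 3) : sideLength T i ^ 2 =
    (T.points (i + 1) 0 - T.points (i + 2) 0) ^ 2
      + (T.points (i + 1) 1 - T.points (i + 2) 1) ^ 2 := dist_sq_eq _ _

theorem sq_add_sq_of_mem {S : Sphere Plane} {P : Plane} (h : P ∈ S) :
    (P 0 - S.center 0) ^ 2 + (P 1 - S.center 1) ^ 2 = S.radius ^ 2 := by
  rw [← dist_sq_eq, mem_sphere.1 h]

/-- Center and radius of the circle of a Brocard porism, up to the sign of the center. -/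
theorem IsBrocardPorism.circle {S : Sphere Plane} {a b : ℝ} (hb : 0 < b) (hab : b ≤ a)
    (h : IsBrocardPorism S a b) :
    S.center 0 = 0 ∧ S.radius = 2 * a ^ 2 / b ∧
      (b * S.center 1) ^ 2 = (a ^ 2 - b ^ 2) * (4 * a ^ 2 - b ^ 2) := by
  obtain ⟨T, rfl, -, hT⟩ := h
  have ha : 0 < a := hb.trans_le hab
  have hD := area₂_ne_zero T
  obtain ⟨q₁, ⟨hq₁, hs₁⟩, hm₁⟩ := hT 0
  obtain ⟨q₂, ⟨hq₂, hs₂⟩, hm₂⟩ := hT 1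
  obtain ⟨q₃, ⟨hq₃, hs₃⟩, hm₃⟩ := hT 2
  obtain ⟨t₁, ht₁, e₁⟩ := exists_isTouchRatio ha.ne' hb.ne' hq₁ hs₁
  obtain ⟨t₂, ht₂, e₂⟩ := exists_isTouchRatio ha.ne' hb.ne' hq₂ hs₂
  obtain ⟨t₃, ht₃, e₃⟩ := exists_isTouchRatio ha.ne' hb.ne' hq₃ hs₃
  have r₁ := symmedian_ratio T 0 hD hm₁ e₁
  have r₂ := symmedian_ratio T 1 (area₂_rotate.trans_ne hD) hm₂ e₂
  obtain ⟨l, m, n, hlmn, k₁, k₂, -⟩ := exists_isDualWeights ha.ne' hb.ne' hD ht₁ ht₂ ht₃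
  have c := fun i => sq_add_sq_of_mem (T.mem_circumsphere i)
  have E₂ : m * sideLength T 1 ^ 2 = n * sideLength T 2 ^ 2 := by
    apply mul_left_cancel₀ ht₁.pos.ne'
    change (1 - t₁) * sideLength T 2 ^ 2 = t₁ * sideLength T 1 ^ 2 at r₁
    linear_combination -m * r₁ - sideLength T 2 ^ 2 * k₁
  have E₁ : l * sideLength T 0 ^ 2 = m * sideLength T 1 ^ 2 := by
    rw [E₂]
    apply mul_left_cancel₀ ht₂.pos.ne'
    change (1 - t₂) * sideLength T 0 ^ 2 = t₂ * sideLength T 2 ^ 2 at r₂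
    linear_combination n * r₂ + sideLength T 0 ^ 2 * k₂
  obtain ⟨hρ, hw, e⟩ := hlmn.circumradius hb hab (sideLength_sq T 0) (sideLength_sq T 1)
    (sideLength_sq T 2) (c 0) (c 1) (c 2) E₁ E₂
  have hc := hlmn.circumcenter hb hab (sideLength_sq T 0) (sideLength_sq T 1)
    (sideLength_sq T 2) (c 0) (c 1) (c 2) hρ hw e (E₁ ▸ e) (E₂ ▸ E₁ ▸ e)
  refine ⟨hc, ?_, ?_⟩
  · have hnn : 0 ≤ T.circumsphere.radius := T.circumradius_nonneg
    rw [eq_div_iff hb.ne', ← pow_left_inj₀ (by positivity) (by positivity) two_ne_zero]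
    linear_combination hρ
  · rw [hc] at hw
    linear_combination hρ - b ^ 2 * hw

/-- The Brocard angle of the triangles of the porism. -/
theorem isBrocardAngle_iff_of_mem_poristicTriangles {S : Sphere Plane} {a b δ : ℝ} (hb : 0 < b)
    (hab : b ≤ a) (hδ : δ = √(4 * a ^ 2 - b ^ 2)) (hx : S.center 0 = 0)
    (hR : S.radius = 2 * a ^ 2 / b)
    (hy : (b * S.center 1) ^ 2 = (a ^ 2 - b ^ 2) * (4 * a ^ 2 - b ^ 2)) {T : PlaneTriangle}
    (hT : T ∈ poristicTriangles S a b) (ω : ℝ) :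
    IsBrocardAngle T ω ↔ ω = Real.pi / 2 - Real.arctan (δ / b) := by
  obtain ⟨hS, hC⟩ := hT
  have ha : 0 < a := hb.trans_le hab
  have hD := area₂_ne_zero T
  obtain ⟨q₁, hq₁, hs₁⟩ := hC 0
  obtain ⟨q₂, hq₂, hs₂⟩ := hC 1
  obtain ⟨q₃, hq₃, hs₃⟩ := hC 2
  obtain ⟨t₁, ht₁, -⟩ := exists_isTouchRatio ha.ne' hb.ne' hq₁ hs₁
  obtain ⟨t₂, ht₂, -⟩ := exists_isTouchRatio ha.ne' hb.ne' hq₂ hs₂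
  obtain ⟨t₃, ht₃, -⟩ := exists_isTouchRatio ha.ne' hb.ne' hq₃ hs₃
  obtain ⟨l, m, n, hlmn, -⟩ := exists_isDualWeights ha.ne' hb.ne' hD ht₁ ht₂ ht₃
  have c := fun i => sq_add_sq_of_mem (hS i)
  have hb2 : b ^ 2 ≠ 0 := by positivity
  have hρ : S.radius ^ 2 * b ^ 2 = 4 * a ^ 4 := by rw [hR]; field_simp; ring
  have key := hlmn.sq_sum_sq_sides ha.ne' hb.ne' (sideLength_sq T 0) (sideLength_sq T 1)
    (sideLength_sq T 2) (c 0) (c 1) (c 2) hρ (by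
      apply mul_right_cancel₀ hb2
      rw [hx]
      linear_combination hρ - hy)
  have hΔ := abs_pos.2 hD
  rw [isBrocardAngle_iff T hΔ (sq_abs _) rfl]
  have hnn : 0 ≤ 4 * a ^ 2 - b ^ 2 := by linarith [pow_le_pow_left₀ hb.le hab 2, sq_nonneg a]
  have hδ2 : δ ^ 2 = 4 * a ^ 2 - b ^ 2 := by rw [hδ, Real.sq_sqrt hnn]
  have hδ0 : 0 ≤ δ := hδ ▸ Real.sqrt_nonneg _
  suffices h : (dist (T.points 1) (T.points 2) ^ 2 + dist (T.points 2) (T.points 0) ^ 2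
      + dist (T.points 0) (T.points 1) ^ 2) / (2 * |area₂ (T.points 0 0) (T.points 0 1)
        (T.points 1 0) (T.points 1 1) (T.points 2 0) (T.points 2 1)|) = δ / b by rw [h]
  rw [div_eq_div_iff (by positivity) hb.ne',
    ← pow_left_inj₀ (by positivity) (by positivity) two_ne_zero, mul_pow, mul_pow, mul_pow, sq_abs,
    hδ2]
  refine key.trans ?_
  ring

/-- The lateral sides of the isosceles triangle with apex `(0, r)` and base vertices `(±x, -b)`
touch the ellipse at the feet of the symmedians. -/
theorem isTouchRatio_lateral {a b x r s : ℝ} (ha : a ≠ 0) (hb : b ≠ 0) (hx : x ≠ 0) (hs : 0 < s)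
    (h₁ : 4 * x ^ 2 * (r - b) = s * b) (h₂ : s * (x ^ 2 - a ^ 2) = 8 * a ^ 2 * x ^ 2) :
    IsTouchRatio a b x (-b) 0 r (4 * x ^ 2 / (s + 4 * x ^ 2)) := by
  have hN : 0 < s + 4 * x ^ 2 := by positivity
  have e : (1 - 4 * x ^ 2 / (s + 4 * x ^ 2)) * -b + 4 * x ^ 2 / (s + 4 * x ^ 2) * r
      = 4 * x ^ 2 * b / (s + 4 * x ^ 2) := by
    field_simp
    linear_combination h₁
  refine ⟨by positivity, by rw [div_lt_one hN]; linarith, ?_, ?_⟩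
  · rw [e]
    field_simp
    linear_combination h₂
  · rw [e]
    field_simp
    linear_combination a ^ 2 * h₁

theorem IsTouchRatio.swap {a b x₂ y₂ x₃ y₃ t : ℝ} (h : IsTouchRatio a b x₂ y₂ x₃ y₃ t) :
    IsTouchRatio a b x₃ y₃ x₂ y₂ (1 - t) := by
  obtain ⟨h0, h1, hl, hr⟩ := h
  exact ⟨by linarith, by linarith, by linear_combination hr, by linear_combination hl⟩

theorem IsTouchRatio.neg {a b x₂ y₂ x₃ y₃ t : ℝ} (h : IsTouchRatio a b x₂ y₂ x₃ y₃ t) :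
    IsTouchRatio a b (-x₂) y₂ (-x₃) y₃ t := by
  obtain ⟨h0, h1, hl, hr⟩ := h
  exact ⟨h0, h1, by linear_combination hl, by linear_combination hr⟩

/-- Parameters of the isosceles triangle of the porism. -/
theorem exists_isosceles_parameters {a b : ℝ} (hb : 0 < b) (hab : b ≤ a) : ∃ x r s : ℝ,
    0 < x ∧ 0 < r ∧ s = x ^ 2 + (r + b) ^ 2 ∧ 4 * x ^ 2 * (r - b) = s * b ∧
      s * (x ^ 2 - a ^ 2) = 8 * a ^ 2 * x ^ 2 ∧ r ^ 2 ≤ x ^ 2 + b ^ 2 := by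
  have ha : 0 < a := hb.trans_le hab
  have hsq := pow_le_pow_left₀ hb.le hab 2
  obtain ⟨d, hd⟩ : ∃ d, d = √((a ^ 2 - b ^ 2) * (4 * a ^ 2 - b ^ 2)) := ⟨_, rfl⟩
  have hd0 : 0 ≤ d := hd ▸ Real.sqrt_nonneg _
  have hd2 : d ^ 2 = (a ^ 2 - b ^ 2) * (4 * a ^ 2 - b ^ 2) := by
    rw [hd, Real.sq_sqrt (mul_nonneg (by linarith) (by linarith [sq_nonneg a]))]
  obtain ⟨t, ht⟩ : ∃ t, t = 2 * a ^ 2 - b ^ 2 - d := ⟨_, rfl⟩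
  have hprod : t * (2 * a ^ 2 - b ^ 2 + d) = (a * b) ^ 2 := by
    rw [ht]; linear_combination -hd2
  have hpos' : 0 < 2 * a ^ 2 - b ^ 2 + d := by linarith [pow_pos ha 2]
  have htpos : 0 < t := by
    have : 0 < t * (2 * a ^ 2 - b ^ 2 + d) := by rw [hprod]; positivity
    exact pos_of_mul_pos_left this hpos'.le
  have htab : t ≤ a * b := by
    rw [← pow_le_pow_iff_left₀ htpos.le (by positivity) two_ne_zero, ← hprod, pow_two]
    exact mul_le_mul_of_nonneg_left (by linarith) htpos.le
  have hquad : t ^ 2 + a ^ 2 * b ^ 2 = (4 * a ^ 2 - 2 * b ^ 2) * t := by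
    rw [ht]; linear_combination hd2
  obtain ⟨x, hx⟩ : ∃ x, x = √(a ^ 2 * (t + 2 * b ^ 2) / t) := ⟨_, rfl⟩
  have hxpos : 0 < x := by rw [hx]; positivity
  have hx2 : x ^ 2 * t = a ^ 2 * (t + 2 * b ^ 2) := by
    rw [hx, Real.sq_sqrt (by positivity)]; field_simp
  obtain ⟨r, hr⟩ : ∃ r, r = b + t / b := ⟨_, rfl⟩
  have hrpos : 0 < r := by rw [hr]; positivity
  have hrb : r * b = b ^ 2 + t := by rw [hr]; field_simp
  obtain ⟨s, hs⟩ : ∃ s, s = x ^ 2 + (r + b) ^ 2 := ⟨_, rfl⟩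
  have hsb : s * b ^ 2 = 4 * x ^ 2 * t := by
    apply mul_right_cancel₀ htpos.ne'
    have : s * b ^ 2 = x ^ 2 * b ^ 2 + (2 * b ^ 2 + t) ^ 2 := by
      rw [hs]; linear_combination (r * b + 3 * b ^ 2 + t) * hrb
    rw [this]
    linear_combination (b ^ 2 - 4 * t) * hx2 + (t + 2 * b ^ 2) * hquad
  refine ⟨x, r, s, hxpos, hrpos, hs, ?_, ?_, ?_⟩
  · apply mul_right_cancel₀ hb.ne'
    linear_combination 4 * x ^ 2 * hrb - hsb
  · apply mul_right_cancel₀ htpos.ne'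
    linear_combination s * hx2 + 2 * a ^ 2 * hsb
  · have h1 : x ^ 2 = 9 * a ^ 2 - 4 * b ^ 2 - 2 * t := by
      apply mul_right_cancel₀ htpos.ne'
      linear_combination hx2 + 2 * hquad
    have h2 : r ^ 2 ≤ (b + a) ^ 2 := by
      apply pow_le_pow_left₀ hrpos.le
      rw [hr]
      have : t / b ≤ a := by rwa [div_le_iff₀ hb]
      linarith
    nlinarith

theorem exists_isBrocardPorism {a b : ℝ} (hb : 0 < b) (hab : b ≤ a) :
    ∃ S : Sphere Plane, IsBrocardPorism S a b ∧ S.center 1 ≤ 0 := by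
  have ha : 0 < a := hb.trans_le hab
  obtain ⟨x, r, s, hx, hr, hs, h₁, h₂, h₃⟩ := exists_isosceles_parameters hb hab
  have hspos : 0 < s := by rw [hs]; positivity
  obtain ⟨P, hP⟩ : ∃ P : Fin 3 → Plane, P = ![!₂[0, r], !₂[-x, -b], !₂[x, -b]] := ⟨_, rfl⟩
  have P00 : P 0 0 = 0 := by rw [hP]; rfl
  have P01 : P 0 1 = r := by rw [hP]; rfl
  have P10 : P 1 0 = -x := by rw [hP]; rfl
  have P11 : P 1 1 = -b := by rw [hP]; rfl
  have P20 : P 2 0 = x := by rw [hP]; rfl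
  have P21 : P 2 1 = -b := by rw [hP]; rfl
  have hD : area₂ (P 0 0) (P 0 1) (P 1 0) (P 1 1) (P 2 0) (P 2 1) ≠ 0 := by
    rw [P00, P01, P10, P11, P20, P21, area₂]
    have : (-x - 0) * (-b - r) - (x - 0) * (-b - r) = 2 * x * (b + r) := by ring
    rw [this]; positivity
  obtain ⟨T, hT⟩ : ∃ T : PlaneTriangle, T.points = P :=
    ⟨⟨P, affineIndependent_of_area₂_ne_zero hD⟩, rfl⟩
  have S0 : sideLength T 0 ^ 2 = 4 * x ^ 2 := by
    refine (sideLength_sq T 0).trans ?_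
    change (T.points 1 0 - T.points 2 0) ^ 2 + (T.points 1 1 - T.points 2 1) ^ 2 = _
    rw [hT, P10, P11, P20, P21]; ring
  have S1 : sideLength T 1 ^ 2 = s := by
    refine (sideLength_sq T 1).trans ?_
    change (T.points 2 0 - T.points 0 0) ^ 2 + (T.points 2 1 - T.points 0 1) ^ 2 = _
    rw [hT, P00, P01, P20, P21, hs]; ring
  have S2 : sideLength T 2 ^ 2 = s := by
    refine (sideLength_sq T 2).trans ?_
    change (T.points 0 0 - T.points 1 0) ^ 2 + (T.points 0 1 - T.points 1 1) ^ 2 = _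
    rw [hT, P00, P01, P10, P11, hs]; ring
  have hlat := isTouchRatio_lateral ha.ne' hb.ne' hx.ne' hspos h₁ h₂
  refine ⟨T.circumsphere, ⟨T, rfl, ?_, fun i => exists_touch_on_symmedian ha.ne' hb.ne' T i ?_⟩, ?_⟩
  · apply plane_ext <;> rw [brocardMidpoint, barycentricPoint_apply T _ 0]
    · change _ * (sideLength T 0 ^ 2 * (sideLength T 1 ^ 2 + sideLength T 2 ^ 2) * T.points 0 0
        + sideLength T 1 ^ 2 * (sideLength T 2 ^ 2 + sideLength T 0 ^ 2) * T.points 1 0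
        + sideLength T 2 ^ 2 * (sideLength T 0 ^ 2 + sideLength T 1 ^ 2) * T.points 2 0) = 0
      rw [S0, S1, S2, hT, P00, P10, P20]
      apply mul_eq_zero_of_right
      ring
    · change _ * (sideLength T 0 ^ 2 * (sideLength T 1 ^ 2 + sideLength T 2 ^ 2) * T.points 0 1
        + sideLength T 1 ^ 2 * (sideLength T 2 ^ 2 + sideLength T 0 ^ 2) * T.points 1 1
        + sideLength T 2 ^ 2 * (sideLength T 0 ^ 2 + sideLength T 1 ^ 2) * T.points 2 1) = 0
      rw [S0, S1, S2, hT, P01, P11, P21]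
      apply mul_eq_zero_of_right
      linear_combination 2 * s * h₁
  · fin_cases i
    · change IsTouchRatio a b (T.points 1 0) (T.points 1 1) (T.points 2 0) (T.points 2 1)
        (sideLength T 2 ^ 2 / (sideLength T 1 ^ 2 + sideLength T 2 ^ 2))
      rw [S1, S2, hT, P10, P11, P20, P21]
      have : s / (s + s) = 1 / 2 := by field_simp; norm_num
      rw [this]
      refine ⟨by norm_num, by norm_num, ?_, ?_⟩ <;> field_simp <;> ring
    · change IsTouchRatio a b (T.points 2 0) (T.points 2 1) (T.points 0 0) (T.points 0 1)
        (sideLength T 0 ^ 2 / (sideLength T 2 ^ 2 + sideLength T 0 ^ 2))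
      rw [S0, S2, hT, P20, P21, P00, P01]
      exact hlat
    · change IsTouchRatio a b (T.points 0 0) (T.points 0 1) (T.points 1 0) (T.points 1 1)
        (sideLength T 1 ^ 2 / (sideLength T 0 ^ 2 + sideLength T 1 ^ 2))
      rw [S0, S1, hT, P10, P11, P00, P01]
      have h := hlat.swap.neg
      have e : 1 - 4 * x ^ 2 / (s + 4 * x ^ 2) = s / (4 * x ^ 2 + s) := by field_simp; ring
      rwa [e, neg_zero] at h
  · have c0 := sq_add_sq_of_mem (T.mem_circumsphere 0)
    have c1 := sq_add_sq_of_mem (T.mem_circumsphere 1)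
    have c2 := sq_add_sq_of_mem (T.mem_circumsphere 2)
    rw [hT] at c0 c1 c2
    rw [P00, P01] at c0
    rw [P10, P11] at c1
    rw [P20, P21] at c2
    have : T.circumsphere.center 1 * (2 * (r + b)) = r ^ 2 - (x ^ 2 + b ^ 2) := by
      linear_combination (c1 + c2) / 2 - c0
    by_contra! h
    have : 0 < T.circumsphere.center 1 * (2 * (r + b)) := by positivity
    linarith

end BrocardPorism

open BrocardPorism in
theorem mainTheorem3 (a b c δ₁ : ℝ) (hb : 0 < b) (hab : b ≤ a)
    (hc : c = √(a ^ 2 - b ^ 2)) (hδ₁ : δ₁ = √(4 * a ^ 2 - b ^ 2)) :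
    (∃ S : EuclideanGeometry.Sphere Plane, IsBrocardPorism S a b ∧ S.center 1 ≤ 0) ∧
    ∀ S : EuclideanGeometry.Sphere Plane, IsBrocardPorism S a b → S.center 1 ≤ 0 →
      S.center = !₂[0, -(c * δ₁ / b)] ∧
      S.radius = 2 * a ^ 2 / b ∧
      ∃ ω : ℝ, Real.cot ω = δ₁ / b ∧
        ∀ T ∈ poristicTriangles S a b, ∀ ω' : ℝ, IsBrocardAngle T ω' ↔ ω' = ω := by
  refine ⟨exists_isBrocardPorism hb hab, fun S hS hneg => ?_⟩
  obtain ⟨hx, hR, hy⟩ := hS.circle hb hab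
  refine ⟨plane_ext hx ?_, hR, Real.pi / 2 - Real.arctan (δ₁ / b), cot_pi_div_two_sub_arctan _,
    fun T hT ω' => isBrocardAngle_iff_of_mem_poristicTriangles hb hab hδ₁ hx hR hy hT ω'⟩
  have hsq := pow_le_pow_left₀ hb.le hab 2
  have hc2 : c ^ 2 = a ^ 2 - b ^ 2 := by rw [hc, Real.sq_sqrt (by linarith)]
  have hδ2 : δ₁ ^ 2 = 4 * a ^ 2 - b ^ 2 := by
    rw [hδ₁, Real.sq_sqrt (by linarith [sq_nonneg a])]
  have hc0 : 0 ≤ c := hc ▸ Real.sqrt_nonneg _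
  have hδ0 : 0 ≤ δ₁ := hδ₁ ▸ Real.sqrt_nonneg _
  have key : b * -S.center 1 = c * δ₁ := by
    rw [← pow_left_inj₀ (mul_nonneg hb.le (by linarith)) (mul_nonneg hc0 hδ0) two_ne_zero,
      mul_pow c, hc2, hδ2, ← hy]
    ring
  change S.center 1 = -(c * δ₁ / b)
  rw [← key]
  field_simp
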